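/- **Setting.** Let $\rho$ be a measure on $\mathbb R$, $\Theta=\{\theta\in\mathbb R:\int e^{\theta x}\,d\rho(x)<\infty\}$ and $b(\theta)=\log\int e^{\theta x}\,d\rho(x)$ for $\theta\in\Theta$. Assume that $b$ is twice differentiable on $\Theta$ (one-sided at an endpoint that belongs to $\Theta$) with $b''>0$. For $\theta\in\Theta$ let $\nu_\theta$ be the distribution with density $e^{\theta x-b(\theta)}$ with respect to $\rho$; it is determined by its mean. For $\theta,\theta'\in\Theta$ with means $\mu,\mu'$ put $\mathrm{kl}(\mu,\mu')=b(\theta')-b(\theta)-b'(\theta)(\theta'-\theta)$. A bandit instance $\mu=(\mu_1,\dots,\mu_K)$ is a $K$-tuple of means of members of this family, arm $i$ having as its reward law the member with mean $\mu_i$. An online algorithm (possibly with a randomized sampling rule) chooses at each time $t\ge1$ an arm $A_t$ on the basis of $A_1,X_1,\dots,A_{t-1},X_{t-1}$ and then observes a reward $X_t$, which given the past and $A_t$ has the law of arm $A_t$. It stops at a stopping time $\tau$ of the filtration $\mathcal F_t=\sigma(A_1,X_1,\dots,A_t,X_t)$ and recommends an $\mathcal F_\tau$-measurable arm $i_{\mathrm{out}}$.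 It is $\delta$-PAC if, for every instance of the family with $K$ arms and a unique best arm (whichever arm that is), $\tau<\infty$ almost surely and the probability that $i_{\mathrm{out}}$ is not the best arm is at most $\delta$. Fix an instance $\mu$ with a unique best arm, numbered $1$. Let $\Delta_i=\mu_1-\mu_i$ and $$\mathrm I^*(\mu)=\sum_{i=2}^K\frac{\Delta_i}{\mathrm{kl}(\mu_i,\mu_1)},\qquad \mathrm{kl}_{\mathcal B}(x,y)=x\log\frac xy+(1-x)\log\frac{1-x}{1-y}.$$ Let $\overline R=\mathbb E_\mu\big[\sum_{t=1}^{\tau}\Delta_{A_t}\big]\in[0,\infty]$ be the expected cumulative regret and $R(\tau)=\sum_{t=1}^{\tau}(\mu_1-X_t)$ the realized cumulative regret up to the stopping time. **Theorem 1 (information-theoretic lower bound).** 1. Let $0<\delta\le\tfrac12$. Every $\delta$-PAC algorithm satisfies $$\overline R\ \ge\ \mathrm I^*(\mu)\,\mathrm{kl}_{\mathcal B}(\delta,1-\delta).$$ If moreover $\mathbb E_\mu[\tau]<\infty$, then $R(\tau)$ is integrable, $\mathbb E_\mu[R(\tau)]=\overline R$, and hence $\mathbb E_\mu[R(\tau)]\ge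 \mathrm I^*(\mu)\,\mathrm{kl}_{\mathcal B}(\delta,1-\delta)$. 2. Consider one algorithm for each $\delta$, such that for all sufficiently small $\delta>0$ the algorithm for $\delta$ is $\delta$-PAC; let $\tau_\delta$ be its stopping time and $\overline R_\delta$ its expected cumulative regret. Then $$\liminf_{\delta\to0^+}\frac{\overline R_\delta}{\log(1/\delta)}\ \ge\ \mathrm I^*(\mu).$$ If moreover $\mathbb E_\mu[\tau_\delta]<\infty$ for all sufficiently small $\delta>0$, then also $$\liminf_{\delta\to0^+}\frac{\mathbb E_\mu[R(\tau_\delta)]}{\log(1/\delta)}\ \ge\ \mathrm I^*(\mu).$$ -/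

import Mathlib

open MeasureTheory ProbabilityTheory Filter Topology
open scoped ENNReal

noncomputable section

namespace BanditBAI

/-! ### Canonical single-parameter exponential families -/

/-- The natural parameter set: all `θ` with `∫ exp (θ x) dρ(x) < ∞`. -/
def naturalParams (ρ : Measure ℝ) : Set ℝ :=
  {θ | Integrable (fun x : ℝ => Real.exp (θ * x)) ρ}

/-- The log-partition function `b(θ) = log ∫ exp (θ x) dρ(x)` (meaningful for natural `θ`). -/
def logPartition (ρ : Measure ℝ) (θ : ℝ) : ℝ :=
  Real.log (∫ x, Real.exp (θ * x) ∂ρ)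

/-- The derivative `b'` of the log-partition function on the natural parameter set.
It is the ordinary derivative at interior points and the one-sided derivative at an endpoint
that belongs to the set. -/
def logPartitionDeriv (ρ : Measure ℝ) (θ : ℝ) : ℝ :=
  derivWithin (logPartition ρ) (naturalParams ρ) θ

/-- A canonical single-parameter exponential family on `ℝ`: a reference measure for which the
log-partition function is twice differentiable on the natural parameter set, with `b'' > 0`. -/
structure ExpFamily where
  /-- the reference measure -/
  base : Measure ℝ
  differentiable : DifferentiableOn ℝ (logPartition base) (naturalParams base)
  differentiable_deriv : DifferentiableOn ℝ (logPartitionDeriv base) (naturalParams base)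
  deriv2_pos : ∀ θ ∈ naturalParams base,
    0 < derivWithin (logPartitionDeriv base) (naturalParams base) θ

namespace ExpFamily

/-- The natural parameter set of the family. -/
def params (F : ExpFamily) : Set ℝ := naturalParams F.base

/-- The distribution `ν_θ`, with density `exp (θ x - b(θ))` with respect to the base measure. -/
def dist (F : ExpFamily) (θ : ℝ) : Measure ℝ :=
  F.base.withDensity fun x => ENNReal.ofReal (Real.exp (θ * x - logPartition F.base θ))

/-- The mean of `ν_θ`. -/
def mean (F : ExpFamily) (θ : ℝ) : ℝ := ∫ x, x ∂(F.dist θ)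

/-- The divergence `kl(μ, μ') = b(θ') - b(θ) - b'(θ) (θ' - θ)` of the members of the family with
parameters `θ, θ'` and means `μ, μ'`. -/
def kl (F : ExpFamily) (θ θ' : ℝ) : ℝ :=
  logPartition F.base θ' - logPartition F.base θ - logPartitionDeriv F.base θ * (θ' - θ)

theorem base_ne_zero (F : ExpFamily) {θ : ℝ} (hθ : θ ∈ F.params) : F.base ≠ 0 := by
  intro h
  have h0 : logPartition F.base = fun _ => 0 := by
    funext t
    simp [logPartition, h]
  have h1 : logPartitionDeriv F.base = fun _ => 0 := by
    funext t
    simp [logPartitionDeriv, h0]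
  have h2 := F.deriv2_pos θ hθ
  simp [h1] at h2

theorem isProbabilityMeasure_dist (F : ExpFamily) {θ : ℝ} (hθ : θ ∈ F.params) :
    IsProbabilityMeasure (F.dist θ) := by
  have hint : Integrable (fun x : ℝ => Real.exp (θ * x)) F.base := hθ
  have : NeZero F.base := ⟨F.base_ne_zero hθ⟩
  have hpos : 0 < ∫ x, Real.exp (θ * x) ∂F.base := integral_exp_pos hint
  have heq : ∀ x : ℝ, Real.exp (θ * x - logPartition F.base θ)
      = Real.exp (θ * x) * (∫ x, Real.exp (θ * x) ∂F.base)⁻¹ := by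
    intro x
    rw [Real.exp_sub, logPartition, Real.exp_log hpos, div_eq_mul_inv]
  constructor
  rw [dist, withDensity_apply _ MeasurableSet.univ, Measure.restrict_univ]
  simp_rw [heq]
  rw [← ofReal_integral_eq_lintegral_ofReal (hint.mul_const _)
    (ae_of_all _ fun x => by positivity), integral_mul_const, mul_inv_cancel₀ hpos.ne']
  simp

end ExpFamily

/-! ### Bandit instances -/

/-- A `K`-armed bandit instance of the family: one natural parameter per arm. -/
structure BanditInstance (F : ExpFamily) (K : ℕ) where
  param : Fin K → ℝ
  mem : ∀ i, param i ∈ F.params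

namespace BanditInstance

variable {F : ExpFamily} {K : ℕ}

/-- The mean `μ_i` of arm `i`. -/
def mean (ν : BanditInstance F K) (i : Fin K) : ℝ := F.mean (ν.param i)

/-- Arm `a` is the unique optimal arm. -/
def IsBest (ν : BanditInstance F K) (a : Fin K) : Prop := ∀ i, i ≠ a → ν.mean i < ν.mean a

/-- The gap `μ_a - μ_i` of arm `i` to arm `a`. -/
def gap (ν : BanditInstance F K) (a i : Fin K) : ℝ := ν.mean a - ν.mean i

/-- The hardness parameter: the sum of `Δ_i / kl(μ_i, μ_a)` over the arms `i ≠ a`. -/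
def hardness (ν : BanditInstance F K) (a : Fin K) : ℝ :=
  ∑ i ∈ Finset.univ.erase a, ν.gap a i / F.kl (ν.param i) (ν.param a)

/-- The reward kernel: pulling arm `i` yields a reward with the law of arm `i`. -/
def rewardKernel (ν : BanditInstance F K) : Kernel (Fin K) ℝ :=
  Kernel.ofFunOfCountable fun i => F.dist (ν.param i)

instance (ν : BanditInstance F K) : IsMarkovKernel ν.rewardKernel :=
  ⟨fun i => F.isProbabilityMeasure_dist (ν.mem i)⟩

end BanditInstance

/-! ### Online algorithms -/

/-- Infinite runs: coordinate `s` is the pair of the `(s + 1)`-th pulled arm and its reward. -/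
abbrev Run (K : ℕ) : Type := ℕ → Fin K × ℝ

/-- The history filtration: `history K t` is generated by the first `t` pulls and rewards. -/
def history (K : ℕ) : Filtration ℕ (MeasurableSpace.pi : MeasurableSpace (Run K)) where
  seq t := ⨆ s : Fin t, MeasurableSpace.comap (fun ω : Run K => ω s) inferInstance
  mono' _ u htu := iSup_le fun s =>
    le_iSup (fun r : Fin u => MeasurableSpace.comap (fun ω : Run K => ω r) inferInstance)
      (Fin.castLE htu s)
  le' _ := iSup_le fun s => (measurable_pi_apply (s : ℕ)).comap_le

/-- An online best arm identification algorithm with `K` arms: the sampling rule gives the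
conditional law of the next arm given all previous pulls and rewards (a Dirac mass for a
non-randomized rule), the stopping time is one of the history filtration, and the
recommendation is measurable with respect to the history up to the stopping time. -/
structure Algorithm (K : ℕ) where
  /-- the law of the first arm -/
  firstArm : Measure (Fin K)
  [firstArm_prob : IsProbabilityMeasure firstArm]
  /-- the law of the next arm given a history of `n + 1` pulls and rewards -/
  nextArm : (n : ℕ) → Kernel (Finset.Iic n → Fin K × ℝ) (Fin K)
  [nextArm_markov : ∀ n, IsMarkovKernel (nextArm n)]
  /-- the number of pulls at which the algorithm stops -/
  stopTime : Run K → WithTop ℕ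
  isStoppingTime : IsStoppingTime (history K) stopTime
  /-- the recommended arm -/
  out : Run K → Fin K
  measurable_out : Measurable[isStoppingTime.measurableSpace] out

attribute [instance] Algorithm.firstArm_prob Algorithm.nextArm_markov

namespace Algorithm

variable {F : ExpFamily} {K : ℕ}

/-- The conditional law of the next pair (arm, reward) given the history: the arm is drawn by
the sampling rule, then the reward from the law of that arm, independently of the past. -/
def stepKernel (π : Algorithm K) (ν : BanditInstance F K) (n : ℕ) :
    Kernel (Finset.Iic n → Fin K × ℝ) (Fin K × ℝ) :=
  π.nextArm n ⊗ₖ Kernel.prodMkLeft (Finset.Iic n → Fin K × ℝ) ν.rewardKernel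

instance (π : Algorithm K) (ν : BanditInstance F K) (n : ℕ) :
    IsMarkovKernel (π.stepKernel ν n) := by
  unfold stepKernel
  infer_instance

/-- The law of the run when the algorithm interacts with the instance. -/
def law (π : Algorithm K) (ν : BanditInstance F K) : Measure (Run K) :=
  Kernel.trajMeasure (X := fun _ => Fin K × ℝ) (π.firstArm ⊗ₘ ν.rewardKernel) (π.stepKernel ν)

/-- The `δ`-PAC property over all instances with a unique best arm: almost sure termination, and
probability of recommending another arm at most `δ`. -/
def IsPAC (F : ExpFamily) (π : Algorithm K) (δ : ℝ) : Prop :=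
  ∀ (ν : BanditInstance F K) (a : Fin K), ν.IsBest a →
    (∀ᵐ ω ∂(π.law ν), π.stopTime ω ≠ ⊤) ∧ π.law ν {ω | π.out ω ≠ a} ≤ ENNReal.ofReal δ

/-- The expected sample complexity `E[τ]`. -/
def expectedStop (π : Algorithm K) (ν : BanditInstance F K) : ℝ≥0∞ :=
  ∫⁻ ω, ENat.toENNReal (π.stopTime ω) ∂(π.law ν)

/-- The expected cumulative regret `E[∑_{t ≤ τ} Δ_{A_t}]`, as an extended nonnegative number. -/
def expectedRegret (π : Algorithm K) (ν : BanditInstance F K) (a : Fin K) : ℝ≥0∞ :=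
  ∫⁻ ω, ∑' s : ℕ,
    (if (s : WithTop ℕ) < π.stopTime ω then ENNReal.ofReal (ν.gap a (ω s).1) else 0) ∂(π.law ν)

/-- The realized cumulative regret `R(τ) = ∑_{t ≤ τ} (μ_a - X_t)` (on the event `τ < ∞`). -/
def realizedRegret (π : Algorithm K) (ν : BanditInstance F K) (a : Fin K) (ω : Run K) : ℝ :=
  ∑ s ∈ Finset.range ((π.stopTime ω).untopD 0), (ν.mean a - (ω s).2)

end Algorithm

/-- The divergence between the Bernoulli distributions with means `x, y ∈ (0, 1)`. -/
def bernoulliKL (x y : ℝ) : ℝ :=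
  x * Real.log (x / y) + (1 - x) * Real.log ((1 - x) / (1 - y))

end BanditBAI

end

/-!
Fix a suboptimal arm `i`. Against the instance in which arm `i` is raised to the parameter `θ_a` of
the best arm `a`, a correct algorithm must tell the two apart, and only pulls of `i` are
informative. That instance has a tie, so it is not covered by the PAC property; it is approached by
instances in which arm `a` is moved down to some `t < θ_a` while arm `i` sits at `θ_a`
(`BanditInstance.swapUp`). Moving `a` down, rather than `i` further up, works even when `θ_a` is
the right endpoint of the parameter set, since `θ_i < θ_a` and the parameter set is convex.

The pulls of `a` then carry information `kl(θ_a, t)` each. The expected number of such pulls up to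
the stopping time `τ` may be infinite, so everything is done up to `min τ n`: there are at most `n`
of them, and `n * kl(θ_a, t) → 0` as `t → θ_a`; afterwards `n → ∞`. The information inequality
used is the variational bound
`c P(E) - log (1 + (exp c - 1) Q(E)) ≤ KL(P, Q)` on the event `E` that the algorithm has stopped
by time `n` with output `a` (`Algorithm.mul_measure_sub_log_le`). It is linear in `P(E)` and
monotone in `Q(E) ≤ δ`, so both limits are immediate, and the weight `c = 2 log ((1 - δ) / δ)`
turns it into `kl_B(δ, 1 - δ)`. Hence `kl_B(δ, 1 - δ) ≤ kl(θ_i, θ_a) E[N_i]` for the number `N_i`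
of pulls of `i` (`Algorithm.bernoulliKL_le_mul_expectedPulls`), and weighting by the gaps and
summing over `i` gives the regret bound.

The relative entropy is never introduced as such: `Algorithm.lintegral_law` disintegrates the law
of a run at each round, which yields the likelihood ratio of two instances up to a deterministic
time, then up to `min τ n`, and the expectation of a stopped sum of functions of arm and reward.
The latter also gives Wald's identity for the realized regret. The input from the exponential
family is that the mean of `ν_θ` equals `b'(θ)`, one-sided endpoints included
(`ExpFamily.integrable_mul_exp_and_integral`), that `b'` is strictly increasing, and that `b` is
continuous on the parameter set.
-/

noncomputable section

namespace BanditBAI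

/-! ### The exponential family: mean, divergence and likelihood ratio -/

namespace ExpFamily

variable (F : ExpFamily) {θ θ' : ℝ}

theorem convex_params : Convex ℝ F.params := by
  refine Set.OrdConnected.convex ⟨fun x hx y hy z hz => ?_⟩
  have hx' : Integrable (fun u : ℝ => Real.exp (x * u)) F.base := hx
  have hy' : Integrable (fun u : ℝ => Real.exp (y * u)) F.base := hy
  refine (hx'.add hy').mono' (by fun_prop) (ae_of_all _ fun u => ?_)
  rw [Real.norm_eq_abs, Real.abs_exp]
  rcases le_total 0 u with hu | hu
  · have : Real.exp (z * u) ≤ Real.exp (y * u) :=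
      Real.exp_le_exp.2 (mul_le_mul_of_nonneg_right hz.2 hu)
    simpa using this.trans (le_add_of_nonneg_left (Real.exp_pos _).le)
  · have : Real.exp (z * u) ≤ Real.exp (x * u) :=
      Real.exp_le_exp.2 (mul_le_mul_of_nonpos_right hz.1 hu)
    simpa using this.trans (le_add_of_nonneg_right (Real.exp_pos _).le)

theorem partition_pos (hθ : θ ∈ F.params) : 0 < ∫ x, Real.exp (θ * x) ∂F.base := by
  have : NeZero F.base := ⟨F.base_ne_zero hθ⟩
  exact integral_exp_pos hθ

/-- The parameter set has no isolated points: a derivative within an isolated point is the junk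
value `0`, which `b'' > 0` excludes. -/
theorem exists_params_ne (hθ : θ ∈ F.params) : ∃ θ' ∈ F.params, θ' ≠ θ := by
  by_contra! h
  have hs : naturalParams F.base = {θ} := by
    ext t
    exact ⟨fun ht => h t ht, fun ht => by rw [Set.mem_singleton_iff.1 ht]; exact hθ⟩
  have := F.deriv2_pos θ hθ
  rw [derivWithin_zero_of_not_accPt] at this
  · exact lt_irrefl _ this
  · rw [hs, accPt_iff_nhds]
    push Not
    exact ⟨Set.univ, univ_mem, by simp⟩

theorem strictMonoOn_logPartitionDeriv : StrictMonoOn (logPartitionDeriv F.base) F.params := by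
  refine strictMonoOn_of_deriv_pos F.convex_params F.differentiable_deriv.continuousOn ?_
  intro x hx
  rw [← derivWithin_of_mem_nhds (mem_interior_iff_mem_nhds.1 hx)]
  exact F.deriv2_pos x (interior_subset hx)

/-- The difference quotients of `t ↦ exp (y t)` at `0` for the increments `1 / n` lie between the
derivative `y` and the quotient for the increment `1`. -/
theorem mul_exp_div_sub_one_bounds (y : ℝ) {n : ℕ} (hn : 0 < n) :
    y ≤ n * (Real.exp (y / n) - 1) ∧ n * (Real.exp (y / n) - 1) ≤ Real.exp y - 1 := by
  have hn' : (0 : ℝ) < n := by exact_mod_cast hn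
  constructor
  · have := Real.add_one_le_exp (y / n)
    calc y = n * (y / n) := by field_simp
      _ ≤ _ := by gcongr; linarith
  · have h := one_add_mul_le_pow (a := Real.exp (y / n) - 1)
      (by linarith [Real.exp_pos (y / n)]) n
    rw [add_sub_cancel, ← Real.exp_nat_mul, mul_div_cancel₀ _ hn'.ne'] at h
    linarith

theorem tendsto_mul_exp_div_sub_one (y : ℝ) :
    Tendsto (fun n : ℕ => ((n + 1 : ℕ) : ℝ) * (Real.exp (y / (n + 1 : ℕ)) - 1)) atTop (𝓝 y) := by
  have hd : HasDerivAt (fun t : ℝ => Real.exp (y * t)) y 0 := by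
    have := ((hasDerivAt_id (0 : ℝ)).const_mul y).exp
    simpa using this
  have h := (hasDerivAt_iff_tendsto_slope.1 hd).comp
    (tendsto_nhdsWithin_iff.2 ⟨tendsto_one_div_add_atTop_nhds_zero_nat (𝕜 := ℝ),
      Eventually.of_forall fun n => by
        simp only [Set.mem_compl_iff, Set.mem_singleton_iff]; positivity⟩)
  refine h.congr fun n => ?_
  simp [slope_def_field, div_eq_mul_inv, mul_comm]

/-- Up to normalization, the mean of `ν_θ` exists and is `b'(θ)`. Sampling the difference quotients
of `θ ↦ ∫ exp (θ x) dρ(x)` along `θ + h / n`, for a direction `h` that stays inside the parameter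
set, reduces the one-sided case to Fatou's lemma (integrability) and dominated convergence
(value). -/
theorem integrable_mul_exp_and_integral (hθ : θ ∈ F.params) :
    Integrable (fun x => x * Real.exp (θ * x)) F.base ∧
      ∫ x, x * Real.exp (θ * x) ∂F.base =
        logPartitionDeriv F.base θ * ∫ x, Real.exp (θ * x) ∂F.base := by
  obtain ⟨θ₁, hθ₁, hne⟩ := F.exists_params_ne hθ
  set h := θ₁ - θ with hh
  have hh0 : h ≠ 0 := sub_ne_zero.2 hne
  set L : ℝ → ℝ := fun t => ∫ x, Real.exp (t * x) ∂F.base with hL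
  have hmem : ∀ n : ℕ, θ + h / (n + 1 : ℕ) ∈ F.params := by
    intro n
    have h1 : (0 : ℝ) ≤ 1 / ((n + 1 : ℕ) : ℝ) := by positivity
    have h2 : (1 : ℝ) / ((n + 1 : ℕ) : ℝ) ≤ 1 := by
      rw [div_le_one (by positivity)]; push_cast; linarith [n.cast_nonneg (α := ℝ)]
    have := F.convex_params hθ hθ₁ (sub_nonneg.2 h2) h1 (by ring)
    convert this using 1
    simp only [smul_eq_mul, hh]; ring
  -- the difference quotients of the partition function converge
  have hLd : HasDerivWithinAt L (L θ * logPartitionDeriv F.base θ) F.params θ := by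
    have h1 := ((F.differentiable θ hθ).hasDerivWithinAt).exp
    refine (h1.congr_of_mem ?_ hθ).congr_deriv ?_
    · intro t ht
      exact (Real.exp_log (F.partition_pos ht)).symm
    · rw [logPartition, Real.exp_log (F.partition_pos hθ)]; rfl
  have hlim : Tendsto (fun n : ℕ => ((n + 1 : ℕ) : ℝ) * (L (θ + h / (n + 1 : ℕ)) - L θ)) atTop
      (𝓝 (h * (L θ * logPartitionDeriv F.base θ))) := by
    have h2 : Tendsto (fun n : ℕ => θ + h / ((n + 1 : ℕ) : ℝ)) atTop (𝓝[F.params \ {θ}] θ) := by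
      refine tendsto_nhdsWithin_iff.2 ⟨?_, Eventually.of_forall fun n => ⟨hmem n, ?_⟩⟩
      · have := (tendsto_one_div_add_atTop_nhds_zero_nat (𝕜 := ℝ)).const_mul h
        have := this.const_add θ
        simpa [div_eq_mul_inv] using this
      · simp only [Set.mem_singleton_iff, add_eq_left]
        exact div_ne_zero hh0 (by positivity)
    have h3 := ((hasDerivWithinAt_iff_tendsto_slope.1 hLd).comp h2).const_mul h
    refine h3.congr fun n => ?_
    simp only [Function.comp, slope_def_field, add_sub_cancel_left]
    field_simp
  set f : ℕ → ℝ → ℝ := fun n x =>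
    Real.exp (θ * x) * (((n + 1 : ℕ) : ℝ) * (Real.exp (h * x / (n + 1 : ℕ)) - 1)) with hf
  have hsplit : ∀ n x, f n x =
      ((n + 1 : ℕ) : ℝ) * (Real.exp ((θ + h / (n + 1 : ℕ)) * x) - Real.exp (θ * x)) := by
    intro n x
    have : (θ + h / ((n + 1 : ℕ) : ℝ)) * x = θ * x + h * x / ((n + 1 : ℕ) : ℝ) := by ring
    simp only [hf]
    rw [this, Real.exp_add]; ring
  have hθi : Integrable (fun x : ℝ => Real.exp (θ * x)) F.base := hθ
  have hfi : ∀ n, Integrable (f n) F.base := by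
    intro n
    have hi : Integrable (fun x : ℝ => Real.exp ((θ + h / (n + 1 : ℕ)) * x)) F.base := hmem n
    exact ((hi.sub hθi).const_mul _).congr (ae_of_all _ fun x => (hsplit n x).symm)
  have hfint : ∀ n, ∫ x, f n x ∂F.base =
      ((n + 1 : ℕ) : ℝ) * (L (θ + h / (n + 1 : ℕ)) - L θ) := by
    intro n
    have hi : Integrable (fun x : ℝ => Real.exp ((θ + h / (n + 1 : ℕ)) * x)) F.base := hmem n
    simp_rw [hsplit n]
    rw [integral_const_mul, integral_sub hi hθi]
  set g : ℝ → ℝ := fun x => Real.exp (θ * x) * (Real.exp (h * x) - 1) with hg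
  have hg0 : g = f 0 := by funext x; simp [hf, hg]
  have hgi : Integrable g F.base := hg0 ▸ hfi 0
  have hle : ∀ n x, Real.exp (θ * x) * (h * x) ≤ f n x := fun n x =>
    mul_le_mul_of_nonneg_left (mul_exp_div_sub_one_bounds _ n.succ_pos).1 (Real.exp_pos _).le
  have hge : ∀ n x, f n x ≤ g x := fun n x =>
    mul_le_mul_of_nonneg_left (mul_exp_div_sub_one_bounds _ n.succ_pos).2 (Real.exp_pos _).le
  have hpt : ∀ x, Tendsto (fun n => f n x) atTop (𝓝 (Real.exp (θ * x) * (h * x))) := fun x =>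
    (tendsto_mul_exp_div_sub_one (h * x)).const_mul _
  have hint : Integrable (fun x => Real.exp (θ * x) * (h * x)) F.base := by
    have hdiff : Integrable (fun x => g x - Real.exp (θ * x) * (h * x)) F.base := by
      refine ⟨(by fun_prop), ?_⟩
      rw [hasFiniteIntegral_iff_ofReal
        (ae_of_all _ fun x => sub_nonneg.2 ((hle 0 x).trans (hge 0 x)))]
      have hlt : ∀ n, ∫⁻ x, ENNReal.ofReal (g x - f n x) ∂F.base =
          ENNReal.ofReal (∫ x, (g x - f n x) ∂F.base) := fun n =>
        (ofReal_integral_eq_lintegral_ofReal (hgi.sub (hfi n))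
          (ae_of_all _ fun x => sub_nonneg.2 (hge n x))).symm
      have hlim2 : Tendsto (fun n => ∫⁻ x, ENNReal.ofReal (g x - f n x) ∂F.base) atTop
          (𝓝 (ENNReal.ofReal (∫ x, g x ∂F.base - h * (L θ * logPartitionDeriv F.base θ)))) := by
        simp_rw [hlt, integral_sub hgi (hfi _), hfint]
        exact (ENNReal.continuous_ofReal.tendsto _).comp (hlim.const_sub _)
      calc ∫⁻ x, ENNReal.ofReal (g x - Real.exp (θ * x) * (h * x)) ∂F.base
          = ∫⁻ x, liminf (fun n => ENNReal.ofReal (g x - f n x)) atTop ∂F.base := by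
            refine lintegral_congr fun x => ?_
            exact (((ENNReal.continuous_ofReal.tendsto _).comp
              ((hpt x).const_sub _)).liminf_eq).symm
        _ ≤ liminf (fun n => ∫⁻ x, ENNReal.ofReal (g x - f n x) ∂F.base) atTop :=
            lintegral_liminf_le fun n => by fun_prop
        _ < ⊤ := by rw [hlim2.liminf_eq]; exact ENNReal.ofReal_lt_top
    exact (hgi.sub hdiff).congr (ae_of_all _ fun x => by simp)
  have hval : ∫ x, Real.exp (θ * x) * (h * x) ∂F.base =
      h * (L θ * logPartitionDeriv F.base θ) := by
    refine tendsto_nhds_unique ?_ (hlim.congr fun n => (hfint n).symm)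
    refine tendsto_integral_of_dominated_convergence
      (fun x => |Real.exp (θ * x) * (h * x)| + |g x|)
      (fun n => by fun_prop) (hint.abs.add hgi.abs) (fun n => ae_of_all _ fun x => ?_)
      (ae_of_all _ hpt)
    rw [Real.norm_eq_abs, abs_le]
    constructor
    · linarith [neg_abs_le (Real.exp (θ * x) * (h * x)), abs_nonneg (g x), hle n x]
    · linarith [le_abs_self (g x), abs_nonneg (Real.exp (θ * x) * (h * x)), hge n x]
  have heq : (fun x => x * Real.exp (θ * x)) =
      fun x => h⁻¹ * (Real.exp (θ * x) * (h * x)) := by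
    funext x; field_simp
  rw [heq]
  refine ⟨hint.const_mul _, ?_⟩
  rw [integral_const_mul, hval]
  field_simp
  exact mul_comm _ _

theorem exp_sub_logPartition (hθ : θ ∈ F.params) (x : ℝ) :
    Real.exp (θ * x - logPartition F.base θ) =
      (∫ x, Real.exp (θ * x) ∂F.base)⁻¹ * Real.exp (θ * x) := by
  rw [Real.exp_sub, logPartition, Real.exp_log (F.partition_pos hθ), div_eq_inv_mul]

theorem integrable_id_dist (hθ : θ ∈ F.params) : Integrable (fun x => x) (F.dist θ) := by
  rw [dist, integrable_withDensity_iff (by fun_prop) (ae_of_all _ fun _ => ENNReal.ofReal_lt_top)]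
  refine ((F.integrable_mul_exp_and_integral hθ).1.const_mul
    (∫ x, Real.exp (θ * x) ∂F.base)⁻¹).congr (ae_of_all _ fun x => ?_)
  simp only [ENNReal.toReal_ofReal (Real.exp_pos _).le]
  rw [F.exp_sub_logPartition hθ]
  ring

theorem mean_eq (hθ : θ ∈ F.params) : F.mean θ = logPartitionDeriv F.base θ := by
  rw [mean, dist, integral_withDensity_eq_integral_toReal_smul (by fun_prop)
    (ae_of_all _ fun _ => ENNReal.ofReal_lt_top)]
  simp only [ENNReal.toReal_ofReal (Real.exp_pos _).le, smul_eq_mul]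
  simp only [F.exp_sub_logPartition hθ, mul_assoc]
  rw [integral_const_mul]
  have := (F.integrable_mul_exp_and_integral hθ).2
  simp_rw [mul_comm (Real.exp _)]
  rw [this]
  field_simp [(F.partition_pos hθ).ne']

theorem strictMonoOn_mean : StrictMonoOn F.mean F.params := by
  intro x hx y hy hxy
  rw [F.mean_eq hx, F.mean_eq hy]
  exact F.strictMonoOn_logPartitionDeriv hx hy hxy

/-- The log-likelihood ratio of `ν_θ` against `ν_θ'` at the observation `x`. -/
def llr (θ θ' x : ℝ) : ℝ :=
  (θ - θ') * x - logPartition F.base θ + logPartition F.base θ'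

@[fun_prop]
theorem measurable_llr (θ θ' : ℝ) : Measurable (F.llr θ θ') := by
  unfold llr; fun_prop

theorem integrable_llr (hθ : θ ∈ F.params) (θ' : ℝ) : Integrable (F.llr θ θ') (F.dist θ) := by
  have := F.isProbabilityMeasure_dist hθ
  exact (((F.integrable_id_dist hθ).const_mul _).sub (integrable_const _)).add (integrable_const _)

theorem integral_llr (hθ : θ ∈ F.params) (θ' : ℝ) :
    ∫ x, F.llr θ θ' x ∂(F.dist θ) = F.kl θ θ' := by
  have := F.isProbabilityMeasure_dist hθ
  have hi := (F.integrable_id_dist hθ).const_mul (θ - θ')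
  have hi' : Integrable (fun x => (θ - θ') * x - logPartition F.base θ) (F.dist θ) :=
    hi.sub (integrable_const _)
  have hm : ∫ x, x ∂(F.dist θ) = logPartitionDeriv F.base θ := F.mean_eq hθ
  simp only [llr]
  rw [integral_add hi' (integrable_const _),
    integral_sub hi (integrable_const _), integral_const_mul, hm]
  simp [kl]
  ring

theorem withDensity_llr (θ θ' : ℝ) :
    (F.dist θ).withDensity (fun x => ENNReal.ofReal (Real.exp (-F.llr θ θ' x))) = F.dist θ' := by
  rw [dist, ← withDensity_mul _ (by fun_prop) (by fun_prop), dist]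
  congr 1
  funext x
  simp only [Pi.mul_apply]
  rw [← ENNReal.ofReal_mul (Real.exp_pos _).le, ← Real.exp_add]
  congr 2
  simp only [llr]
  ring

theorem kl_self (θ : ℝ) : F.kl θ θ = 0 := by simp [kl]

theorem kl_nonneg (hθ : θ ∈ F.params) (hθ' : θ' ∈ F.params) : 0 ≤ F.kl θ θ' := by
  have := F.isProbabilityMeasure_dist hθ
  have := F.isProbabilityMeasure_dist hθ'
  have hlin : ∫⁻ x, ENNReal.ofReal (Real.exp (-F.llr θ θ' x)) ∂(F.dist θ) = 1 := by
    rw [← setLIntegral_univ, ← withDensity_apply _ MeasurableSet.univ, F.withDensity_llr,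
      measure_univ]
  have hint : Integrable (fun x => Real.exp (-F.llr θ θ' x)) (F.dist θ) := by
    refine ⟨by fun_prop, ?_⟩
    rw [hasFiniteIntegral_iff_ofReal (ae_of_all _ fun x => (Real.exp_pos _).le), hlin]
    exact ENNReal.one_lt_top
  have hone : ∫ x, Real.exp (-F.llr θ θ' x) ∂(F.dist θ) = 1 := by
    rw [integral_eq_lintegral_of_nonneg_ae (ae_of_all _ fun x => (Real.exp_pos _).le)
      (by fun_prop), hlin, ENNReal.toReal_one]
  have h := integral_mono (F.integrable_llr hθ θ').neg (hint.sub (integrable_const 1)) fun x => by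
    have := Real.add_one_le_exp (-F.llr θ θ' x)
    simp only [Pi.neg_apply, Pi.sub_apply]; linarith
  simp only [Pi.neg_apply, Pi.sub_apply] at h
  rw [integral_neg, F.integral_llr hθ, integral_sub hint (integrable_const _), hone] at h
  simp at h
  exact h

theorem tendsto_kl (hθ : θ ∈ F.params) :
    Tendsto (fun t => F.kl θ t) (𝓝[F.params] θ) (𝓝 0) := by
  have hb : Tendsto (logPartition F.base) (𝓝[F.params] θ) (𝓝 (logPartition F.base θ)) :=
    F.differentiable.continuousOn θ hθ
  have hid : Tendsto (fun t : ℝ => t) (𝓝[F.params] θ) (𝓝 θ) := tendsto_id.mono_left inf_le_left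
  have := (hb.sub_const (logPartition F.base θ)).sub
    ((hid.sub_const θ).const_mul (logPartitionDeriv F.base θ))
  simpa [kl] using this

end ExpFamily

/-! ### The law of a run, one round at a time -/

/-- The first `s` rounds of a run. -/
def runPrefix (K s : ℕ) (ω : Run K) : Fin s → Fin K × ℝ := fun i => ω i

@[fun_prop]
theorem measurable_runPrefix (K s : ℕ) : Measurable (runPrefix K s) :=
  measurable_pi_lambda _ fun i => measurable_pi_apply (i : ℕ)

theorem history_eq_comap (K s : ℕ) :
    history K s = MeasurableSpace.comap (runPrefix K s) inferInstance := by
  change (⨆ i : Fin s, MeasurableSpace.comap (fun ω : Run K => ω i) inferInstance) = _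
  simp only [MeasurableSpace.pi, MeasurableSpace.comap_iSup, MeasurableSpace.comap_comp]
  rfl

/-- A function measurable with respect to the history is a function of the run prefix. -/
theorem exists_eq_comp_runPrefix {K s : ℕ} {H : Run K → ℝ≥0∞} (hH : Measurable[history K s] H) :
    ∃ h : (Fin s → Fin K × ℝ) → ℝ≥0∞, Measurable h ∧ H = h ∘ runPrefix K s := by
  rw [history_eq_comap] at hH
  exact hH.exists_eq_measurable_comp

theorem runPrefix_succ {K s : ℕ} (ω : Run K) :
    runPrefix K (s + 1) ω = Fin.snoc (α := fun _ => Fin K × ℝ) (runPrefix K s ω) (ω s) := by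
  funext i
  refine Fin.lastCases ?_ (fun j => ?_) i
  · simp [runPrefix]
  · simp [runPrefix]

@[fun_prop]
theorem measurable_snoc (K s : ℕ) :
    Measurable fun p : (Fin s → Fin K × ℝ) × (Fin K × ℝ) =>
      Fin.snoc (α := fun _ => Fin K × ℝ) p.1 p.2 := by
  refine measurable_pi_lambda _ fun i => ?_
  refine Fin.lastCases ?_ (fun j => ?_) i
  · simpa using measurable_snd
  · simpa using measurable_fst.eval

namespace Algorithm

variable {F : ExpFamily} {K : ℕ}

instance (π : Algorithm K) (ν : BanditInstance F K) : IsProbabilityMeasure (π.law ν) := by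
  unfold law; infer_instance

/-- The sampling rule with the first round included: the law of the next arm as a kernel of the
first `s` rounds, for every `s`. -/
def armKernel (π : Algorithm K) : (s : ℕ) → Kernel (Fin s → Fin K × ℝ) (Fin K)
  | 0 => Kernel.const _ π.firstArm
  | n + 1 => (π.nextArm n).comap
      (fun p i => p ⟨i, Nat.lt_succ_of_le (Finset.mem_Iic.1 i.2)⟩) (by fun_prop)

instance (π : Algorithm K) (s : ℕ) : IsMarkovKernel (π.armKernel s) := by
  cases s <;> (unfold armKernel; infer_instance)

theorem lintegral_law_zero (π : Algorithm K) (ν : BanditInstance F K) {h : Fin K × ℝ → ℝ≥0∞}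
    (hh : Measurable h) :
    ∫⁻ ω, h (ω 0) ∂(π.law ν) = ∫⁻ y, h y ∂(π.firstArm ⊗ₘ ν.rewardKernel) := by
  have : (π.law ν).map (Preorder.frestrictLe 0) =
      (π.firstArm ⊗ₘ ν.rewardKernel).map
        (MeasurableEquiv.piUnique (fun _ : Finset.Iic 0 => Fin K × ℝ)).symm := by
    rw [law, Kernel.trajMeasure, Measure.map_comp _ _ (by fun_prop), Kernel.traj_map_frestrictLe,
      Kernel.partialTraj_self, Measure.id_comp]
  have h2 := congrArg (fun m => ∫⁻ p, h (p ⟨0, by simp⟩) ∂m) this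
  rw [lintegral_map (by fun_prop) (by fun_prop), lintegral_map (by fun_prop) (by fun_prop)] at h2
  exact h2

/-- The disintegration of the law of a run at round `s`: given the first `s` rounds, the arm
follows the sampling rule and the reward the law of that arm. -/
theorem lintegral_law (π : Algorithm K) (ν : BanditInstance F K) (s : ℕ)
    {h : (Fin s → Fin K × ℝ) → Fin K → ℝ → ℝ≥0∞}
    (hh : Measurable fun p : (Fin s → Fin K × ℝ) × (Fin K × ℝ) => h p.1 p.2.1 p.2.2) :
    ∫⁻ ω, h (runPrefix K s ω) (ω s).1 (ω s).2 ∂(π.law ν) =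
      ∫⁻ ω, ∫⁻ j, ∫⁻ x, h (runPrefix K s ω) j x ∂(F.dist (ν.param j))
        ∂(π.armKernel s (runPrefix K s ω)) ∂(π.law ν) := by
  cases s with
  | zero =>
    have hp : ∀ ω : Run K, runPrefix K 0 ω = Fin.elim0 := fun ω => Subsingleton.elim _ _
    have hh0 : Measurable fun y : Fin K × ℝ => h Fin.elim0 y.1 y.2 :=
      hh.comp (measurable_const.prodMk measurable_id)
    simp only [hp]
    rw [π.lintegral_law_zero ν hh0, Measure.lintegral_compProd hh0, lintegral_const, measure_univ,
      mul_one]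
    rfl
  | succ n =>
    set e : (Finset.Iic n → Fin K × ℝ) → (Fin (n + 1) → Fin K × ℝ) :=
      fun p i => p ⟨i, Finset.mem_Iic.2 (Nat.le_of_lt_succ i.2)⟩ with he
    have hem : Measurable e := by fun_prop
    have hG : Measurable fun p : (Finset.Iic n → Fin K × ℝ) × (Fin K × ℝ) =>
        h (e p.1) p.2.1 p.2.2 :=
      hh.comp ((hem.comp measurable_fst).prodMk measurable_snd)
    have key := congrArg (fun m => ∫⁻ p, h (e p.1) p.2.1 p.2.2 ∂m)
      (Kernel.map_frestrictLe_trajMeasure_compProd_eq_map_trajMeasure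
        (X := fun _ => Fin K × ℝ) (μ₀ := π.firstArm ⊗ₘ ν.rewardKernel)
        (κ := π.stepKernel ν) (a := n))
    rw [Measure.lintegral_compProd hG, lintegral_map hG.lintegral_kernel_prod_right' (by fun_prop),
      lintegral_map hG (by fun_prop)] at key
    refine key.symm.trans (lintegral_congr fun ω => ?_)
    exact Kernel.lintegral_compProd _ _ _ (hG.comp measurable_prodMk_left)

end Algorithm

/-! ### Change of measure and the reward of a single round -/

namespace BanditInstance

variable {F : ExpFamily} {K : ℕ}

/-- The log-likelihood ratio of `ν` against `ν'` contributed by one round. -/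
def stepLLR (ν ν' : BanditInstance F K) (y : Fin K × ℝ) : ℝ :=
  F.llr (ν.param y.1) (ν'.param y.1) y.2

@[fun_prop]
theorem measurable_stepLLR (ν ν' : BanditInstance F K) : Measurable (ν.stepLLR ν') :=
  measurable_from_prod_countable_right fun j =>
    F.measurable_llr (ν.param j) (ν'.param j)

theorem integrable_stepLLR (ν ν' : BanditInstance F K) (j : Fin K) :
    Integrable (fun x => ν.stepLLR ν' (j, x)) (F.dist (ν.param j)) :=
  F.integrable_llr (ν.mem j) (ν'.param j)

theorem lintegral_mul_exp_neg_stepLLR (ν ν' : BanditInstance F K) (j : Fin K) {g : ℝ → ℝ≥0∞}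
    (hg : Measurable g) :
    ∫⁻ x, g x * ENNReal.ofReal (Real.exp (-ν.stepLLR ν' (j, x))) ∂(F.dist (ν.param j)) =
      ∫⁻ x, g x ∂(F.dist (ν'.param j)) := by
  rw [← F.withDensity_llr (ν.param j) (ν'.param j),
    lintegral_withDensity_eq_lintegral_mul _ (by fun_prop) hg]
  simp only [Pi.mul_apply, mul_comm]
  rfl

end BanditInstance

namespace Algorithm

variable {F : ExpFamily} {K : ℕ}

/-- The law of the first `s` rounds under `ν'` has density `exp (-LLR)` with respect to the law
under `ν`: the sampling rule is the same under both and cancels. -/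
theorem lintegral_runPrefix_change (π : Algorithm K) (ν ν' : BanditInstance F K) (s : ℕ)
    {h : (Fin s → Fin K × ℝ) → ℝ≥0∞} (hh : Measurable h) :
    ∫⁻ ω, h (runPrefix K s ω) ∂(π.law ν') =
      ∫⁻ ω, h (runPrefix K s ω) *
        ENNReal.ofReal (Real.exp (-∑ r ∈ Finset.range s, ν.stepLLR ν' (ω r))) ∂(π.law ν) := by
  induction s with
  | zero =>
    have hp : ∀ ω : Run K, runPrefix K 0 ω = Fin.elim0 := fun ω => Subsingleton.elim _ _
    simp [hp]
  | succ s ih =>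
    set D : (Fin s → Fin K × ℝ) → ℝ≥0∞ := fun p =>
      ENNReal.ofReal (Real.exp (-∑ i, ν.stepLLR ν' (p i))) with hD
    have hDm : Measurable D := by fun_prop
    have hDp : ∀ ω : Run K, ENNReal.ofReal
        (Real.exp (-∑ r ∈ Finset.range s, ν.stepLLR ν' (ω r))) = D (runPrefix K s ω) := by
      intro ω
      simp only [hD, runPrefix]
      rw [Fin.sum_univ_eq_sum_range (fun r => ν.stepLLR ν' (ω r)) s]
    have hsn : Measurable fun p : (Fin s → Fin K × ℝ) × (Fin K × ℝ) =>
        h (Fin.snoc (α := fun _ => Fin K × ℝ) p.1 p.2) := hh.comp (measurable_snoc K s)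
    set g : (Fin s → Fin K × ℝ) → ℝ≥0∞ := fun p =>
      ∫⁻ j, ∫⁻ x, h (Fin.snoc (α := fun _ => Fin K × ℝ) p (j, x)) ∂(F.dist (ν'.param j))
        ∂(π.armKernel s p) with hg
    have hgm : Measurable g := by
      have h1 : Measurable fun q : (Fin s → Fin K × ℝ) × Fin K =>
          ∫⁻ x, h (Fin.snoc (α := fun _ => Fin K × ℝ) q.1 (q.2, x))
            ∂(Kernel.prodMkLeft (Fin s → Fin K × ℝ) ν'.rewardKernel q) :=
        Measurable.lintegral_kernel_prod_right'
          (f := fun r : ((Fin s → Fin K × ℝ) × Fin K) × ℝ =>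
            h (Fin.snoc (α := fun _ => Fin K × ℝ) r.1.1 (r.1.2, r.2)))
          (hsn.comp (by fun_prop :
            Measurable fun r : ((Fin s → Fin K × ℝ) × Fin K) × ℝ => (r.1.1, (r.1.2, r.2))))
      exact h1.lintegral_kernel_prod_right'
    have hL : ∫⁻ ω, h (runPrefix K (s + 1) ω) ∂(π.law ν') =
        ∫⁻ ω, g (runPrefix K s ω) ∂(π.law ν') := by
      simp only [runPrefix_succ]
      exact π.lintegral_law ν' s
        (h := fun p j x => h (Fin.snoc (α := fun _ => Fin K × ℝ) p (j, x))) hsn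
    rw [hL, ih hgm]
    have hsplit : ∀ ω : Run K, ENNReal.ofReal
        (Real.exp (-∑ r ∈ Finset.range (s + 1), ν.stepLLR ν' (ω r))) =
        D (runPrefix K s ω) * ENNReal.ofReal (Real.exp (-ν.stepLLR ν' ((ω s).1, (ω s).2))) := by
      intro ω
      rw [← hDp, ← ENNReal.ofReal_mul (Real.exp_pos _).le, ← Real.exp_add,
        Finset.sum_range_succ, neg_add]
    simp only [runPrefix_succ, hsplit, hDp]
    refine Eq.trans ?_ (π.lintegral_law ν s (h := fun p j x =>
      h (Fin.snoc (α := fun _ => Fin K × ℝ) p (j, x)) *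
        (D p * ENNReal.ofReal (Real.exp (-ν.stepLLR ν' (j, x))))) ?_).symm
    · refine lintegral_congr fun ω => ?_
      set p := runPrefix K s ω
      have hx : ∀ j, Measurable fun x : ℝ => h (Fin.snoc (α := fun _ => Fin K × ℝ) p (j, x)) :=
        fun j => hsn.comp (by fun_prop : Measurable fun x : ℝ => (p, (j, x)))
      have : ∀ j, ∫⁻ x, h (Fin.snoc (α := fun _ => Fin K × ℝ) p (j, x)) *
          (D p * ENNReal.ofReal (Real.exp (-ν.stepLLR ν' (j, x)))) ∂(F.dist (ν.param j)) =
          (∫⁻ x, h (Fin.snoc (α := fun _ => Fin K × ℝ) p (j, x)) ∂(F.dist (ν'.param j))) * D p := by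
        intro j
        rw [← ν.lintegral_mul_exp_neg_stepLLR ν' j (hx j), ← lintegral_mul_const _
          (by have := hx j; fun_prop)]
        refine lintegral_congr fun x => ?_
        ring
      simp only [this]
      rw [lintegral_mul_const _ (measurable_of_countable _)]
    · exact hsn.mul ((hDm.comp measurable_fst).mul (by fun_prop))

theorem law_eq_setLIntegral (π : Algorithm K) (ν ν' : BanditInstance F K) (s : ℕ)
    {E : Set (Run K)} (hE : MeasurableSet[history K s] E) :
    π.law ν' E = ∫⁻ ω in E,
      ENNReal.ofReal (Real.exp (-∑ r ∈ Finset.range s, ν.stepLLR ν' (ω r))) ∂(π.law ν) := by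
  have hEm : MeasurableSet E := (history K).le s E hE
  obtain ⟨h, hh, hEq⟩ := exists_eq_comp_runPrefix
    ((measurable_const (a := (1 : ℝ≥0∞))).indicator hE)
  have := π.lintegral_runPrefix_change ν ν' s hh
  rw [← lintegral_indicator_one hEm, ← lintegral_indicator hEm]
  have hE2 : ∀ ω, h (runPrefix K s ω) = E.indicator (fun _ => 1) ω := fun ω => (congrFun hEq ω).symm
  simp only [hE2] at this
  refine this.trans (lintegral_congr fun ω => ?_)
  by_cases hω : ω ∈ E <;> simp [hω]

theorem measurableSet_lt_stopTime (π : Algorithm K) (s : ℕ) :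
    MeasurableSet[history K s] {ω | (s : WithTop ℕ) < π.stopTime ω} :=
  π.isStoppingTime.measurableSet_gt s

/-- The probability that round `s` (counted from `0`) is played and pulls arm `j`. -/
def pullProb (π : Algorithm K) (ν : BanditInstance F K) (s : ℕ) (j : Fin K) : ℝ≥0∞ :=
  π.law ν {ω | (s : WithTop ℕ) < π.stopTime ω ∧ (ω s).1 = j}

theorem measurableSet_pull (π : Algorithm K) (s : ℕ) (j : Fin K) :
    MeasurableSet {ω : Run K | (s : WithTop ℕ) < π.stopTime ω ∧ (ω s).1 = j} :=
  ((history K).le s _ (π.measurableSet_lt_stopTime s)).inter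
    ((by fun_prop : Measurable fun ω : Run K => (ω s).1) (measurableSet_singleton j))

theorem pullProb_ne_top (π : Algorithm K) (ν : BanditInstance F K) (s : ℕ) (j : Fin K) :
    π.pullProb ν s j ≠ ⊤ := measure_ne_top _ _

/-- Whether round `s` is played and which arm it pulls is decided before the reward is drawn, so on
the event that arm `j` is pulled the reward still has the law of arm `j`. -/
theorem map_reward_restrict (π : Algorithm K) (ν : BanditInstance F K) (s : ℕ) (j : Fin K) :
    ((π.law ν).restrict {ω | (s : WithTop ℕ) < π.stopTime ω ∧ (ω s).1 = j}).map
      (fun ω => (ω s).2) = π.pullProb ν s j • F.dist (ν.param j) := by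
  have hS := π.measurableSet_pull s j
  obtain ⟨h, hh, hEq⟩ := exists_eq_comp_runPrefix
    ((measurable_const (a := (1 : ℝ≥0∞))).indicator (π.measurableSet_lt_stopTime s))
  have hG : ∀ ω, h (runPrefix K s ω) =
      {ω | (s : WithTop ℕ) < π.stopTime ω}.indicator (fun _ => 1) ω :=
    fun ω => (congrFun hEq ω).symm
  have key : ∀ B : Set ℝ, MeasurableSet B →
      π.law ν ({ω | (s : WithTop ℕ) < π.stopTime ω ∧ (ω s).1 = j} ∩ {ω | (ω s).2 ∈ B}) =
      (∫⁻ ω, h (runPrefix K s ω) * π.armKernel s (runPrefix K s ω) {j} ∂(π.law ν)) *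
        F.dist (ν.param j) B := by
    intro B hB
    have hm : Measurable fun p : (Fin s → Fin K × ℝ) × (Fin K × ℝ) =>
        h p.1 * (({j} : Set (Fin K)).indicator (fun _ => 1) p.2.1 *
          B.indicator (fun _ => 1) p.2.2 : ℝ≥0∞) := by
      refine (hh.comp measurable_fst).mul (Measurable.mul ?_ ?_)
      · exact (measurable_const.indicator (measurableSet_singleton j)).comp
          (measurable_fst.comp measurable_snd)
      · exact (measurable_const.indicator hB).comp (measurable_snd.comp measurable_snd)
    have h1 := π.lintegral_law ν s (h := fun p i x =>
        h p * (({j} : Set (Fin K)).indicator (fun _ => 1) i * B.indicator (fun _ => 1) x)) hm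
    have h2 : ∫⁻ ω, h (runPrefix K s ω) * (({j} : Set (Fin K)).indicator (fun _ => 1) (ω s).1 *
        B.indicator (fun _ => 1) (ω s).2) ∂(π.law ν) =
        π.law ν ({ω | (s : WithTop ℕ) < π.stopTime ω ∧ (ω s).1 = j} ∩ {ω | (ω s).2 ∈ B}) := by
      have hB' : MeasurableSet {ω : Run K | (ω s).2 ∈ B} :=
        (by fun_prop : Measurable fun ω : Run K => (ω s).2) hB
      rw [← lintegral_indicator_one (hS.inter hB')]
      refine lintegral_congr fun ω => ?_
      rw [hG]
      by_cases c1 : (s : WithTop ℕ) < π.stopTime ω <;> by_cases c2 : (ω s).1 = j <;>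
        by_cases c3 : (ω s).2 ∈ B <;> simp [Set.indicator, c1, c2, c3]
    rw [← h2, h1, ← lintegral_mul_const']
    · refine lintegral_congr fun ω => ?_
      have h3 : ∀ i, ∫⁻ x, h (runPrefix K s ω) * (({j} : Set (Fin K)).indicator (fun _ => 1) i *
          B.indicator (fun _ => 1) x) ∂(F.dist (ν.param i)) =
          h (runPrefix K s ω) * ((({j} : Set (Fin K)).indicator
            (fun _ => F.dist (ν.param j) B)) i) := by
        intro i
        rw [lintegral_const_mul _ (by
          exact (measurable_const.indicator hB).const_mul _),
          lintegral_const_mul _ (measurable_const.indicator hB)]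
        by_cases hi : i = j
        · subst hi
          rw [lintegral_indicator hB]; simp
        · simp [hi]
      simp only [h3]
      rw [lintegral_const_mul _ (measurable_of_countable _),
        lintegral_indicator (measurableSet_singleton j), lintegral_const]
      simp only [Measure.restrict_apply MeasurableSet.univ, Set.univ_inter]
      ring
    · have := F.isProbabilityMeasure_dist (ν.mem j)
      exact measure_ne_top _ _
  have hp : π.pullProb ν s j =
      ∫⁻ ω, h (runPrefix K s ω) * π.armKernel s (runPrefix K s ω) {j} ∂(π.law ν) := by
    have := F.isProbabilityMeasure_dist (ν.mem j)
    simpa [pullProb] using key Set.univ MeasurableSet.univ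
  ext B hB
  rw [Measure.map_apply (by fun_prop) hB, Measure.restrict_apply' hS, Set.inter_comm,
    Measure.smul_apply, smul_eq_mul, hp]
  exact key B hB

theorem ite_stopTime_eq_sum (π : Algorithm K) (s : ℕ) {M : Type*} [AddCommMonoid M]
    (φ : Fin K → ℝ → M) (ω : Run K) :
    (if (s : WithTop ℕ) < π.stopTime ω then φ (ω s).1 (ω s).2 else 0) =
      ∑ j, {ω : Run K | (s : WithTop ℕ) < π.stopTime ω ∧ (ω s).1 = j}.indicator
        (fun ω => φ j (ω s).2) ω := by
  by_cases h : (s : WithTop ℕ) < π.stopTime ω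
  · simp [Set.indicator, h]
  · simp [Set.indicator, h]

theorem integrable_ite_stopTime (π : Algorithm K) (ν : BanditInstance F K) (s : ℕ)
    {φ : Fin K → ℝ → ℝ} (hφ : ∀ j, Integrable (φ j) (F.dist (ν.param j))) :
    Integrable (fun ω : Run K => if (s : WithTop ℕ) < π.stopTime ω then φ (ω s).1 (ω s).2 else 0)
      (π.law ν) := by
  simp only [π.ite_stopTime_eq_sum s φ]
  refine integrable_finsetSum _ fun j _ => ?_
  rw [integrable_indicator_iff (π.measurableSet_pull s j)]
  have := (hφ j).smul_measure (π.pullProb_ne_top ν s j)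
  rw [← π.map_reward_restrict ν s j] at this
  exact this.comp_measurable (by fun_prop)

/-- Wald's identity for a single round: `φ` of the arm and reward may be replaced by its mean given
the arm. -/
theorem integral_ite_stopTime (π : Algorithm K) (ν : BanditInstance F K) (s : ℕ)
    {φ : Fin K → ℝ → ℝ} (hφ : ∀ j, Integrable (φ j) (F.dist (ν.param j))) :
    ∫ ω, (if (s : WithTop ℕ) < π.stopTime ω then φ (ω s).1 (ω s).2 else 0) ∂(π.law ν) =
      ∑ j, (π.pullProb ν s j).toReal * ∫ x, φ j x ∂(F.dist (ν.param j)) := by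
  have hi : ∀ j, Integrable (φ j) (((π.law ν).restrict
      {ω | (s : WithTop ℕ) < π.stopTime ω ∧ (ω s).1 = j}).map (fun ω => (ω s).2)) := by
    intro j
    rw [π.map_reward_restrict ν s j]
    exact (hφ j).smul_measure (π.pullProb_ne_top ν s j)
  simp only [π.ite_stopTime_eq_sum s φ]
  rw [integral_finsetSum]
  · refine Finset.sum_congr rfl fun j _ => ?_
    rw [integral_indicator (π.measurableSet_pull s j),
      ← integral_map (f := φ j)
        (by fun_prop : Measurable fun ω : Run K => (ω s).2).aemeasurable (hi j).1,
      π.map_reward_restrict ν s j,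
      integral_smul_measure, smul_eq_mul]
  · intro j _
    rw [integrable_indicator_iff (π.measurableSet_pull s j)]
    exact (hi j).comp_measurable (by fun_prop)

end Algorithm

/-! ### Relative entropy up to the stopping time -/

namespace Algorithm

variable {F : ExpFamily} {K : ℕ}

/-- The log-likelihood ratio of `ν` against `ν'` accumulated up to the truncated stopping time
`min τ n`. -/
def stoppedLLR (π : Algorithm K) (ν ν' : BanditInstance F K) (n : ℕ) (ω : Run K) : ℝ :=
  ∑ s ∈ Finset.range n, if (s : WithTop ℕ) < π.stopTime ω then ν.stepLLR ν' (ω s) else 0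

theorem integrable_stoppedLLR (π : Algorithm K) (ν ν' : BanditInstance F K) (n : ℕ) :
    Integrable (π.stoppedLLR ν ν' n) (π.law ν) := by
  unfold stoppedLLR
  refine integrable_finsetSum _ fun s _ => ?_
  have h := π.integrable_ite_stopTime ν s (ν.integrable_stepLLR ν')
  exact h

theorem integral_stoppedLLR (π : Algorithm K) (ν ν' : BanditInstance F K) (n : ℕ) :
    ∫ ω, π.stoppedLLR ν ν' n ω ∂(π.law ν) =
      ∑ s ∈ Finset.range n, ∑ j, (π.pullProb ν s j).toReal * F.kl (ν.param j) (ν'.param j) := by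
  unfold stoppedLLR
  rw [integral_finsetSum]
  · refine Finset.sum_congr rfl fun s _ => ?_
    have h := π.integral_ite_stopTime ν s (ν.integrable_stepLLR ν')
    refine h.trans (Finset.sum_congr rfl fun j _ => ?_)
    rw [← F.integral_llr (ν.mem j)]
    rfl
  · intro s _
    have h := π.integrable_ite_stopTime ν s (ν.integrable_stepLLR ν')
    exact h

/-- Change of measure up to `min τ n`, obtained from the change of measure at the deterministic
times `k ≤ n` on the events `min τ n = k`. -/
theorem law_eq_setLIntegral_stoppedLLR (π : Algorithm K) (ν ν' : BanditInstance F K) (n : ℕ)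
    {E : Set (Run K)}
    (hE : MeasurableSet[(π.isStoppingTime.min_const n).measurableSpace] E) :
    π.law ν' E = ∫⁻ ω in E, ENNReal.ofReal (Real.exp (-π.stoppedLLR ν ν' n ω)) ∂(π.law ν) := by
  set hσ := π.isStoppingTime.min_const n with hσdef
  set S : ℕ → Set (Run K) := fun k => E ∩ {ω | min (π.stopTime ω) (n : WithTop ℕ) = k} with hS
  have hSk : ∀ k, MeasurableSet[history K k] (S k) := by
    intro k
    refine (hσ.measurableSet_inter_eq_iff E k).1 ?_
    exact MeasurableSet.inter hE (hσ.measurableSet_eq_of_countable' k)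
  have hSm : ∀ k, MeasurableSet (S k) := fun k => (history K).le k _ (hSk k)
  have hun : E = ⋃ k ∈ Finset.range (n + 1), S k := by
    ext ω
    simp only [hS, Set.mem_iUnion, Set.mem_inter_iff, Set.mem_ofPred_eq, Finset.mem_range,
      exists_prop]
    constructor
    · intro hω
      have hne : min (π.stopTime ω) (n : WithTop ℕ) ≠ ⊤ :=
        ((min_le_right _ _).trans_lt (WithTop.coe_lt_top n)).ne
      obtain ⟨k, hk⟩ := WithTop.ne_top_iff_exists.1 hne
      refine ⟨k, ?_, hω, hk.symm⟩
      have : (k : WithTop ℕ) ≤ n := hk.trans_le (min_le_right _ _)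
      exact Nat.lt_succ_of_le (WithTop.coe_le_coe.1 this)
    · rintro ⟨k, -, hω, -⟩
      exact hω
  have hdisj : Set.PairwiseDisjoint (↑(Finset.range (n + 1))) S := by
    intro k _ l _ hkl
    refine Set.disjoint_left.2 fun ω h1 h2 => hkl ?_
    exact WithTop.coe_injective (h1.2.symm.trans h2.2)
  rw [hun, measure_biUnion_finset hdisj fun k _ => hSm k,
    lintegral_biUnion_finset hdisj fun k _ => hSm k]
  refine Finset.sum_congr rfl fun k hk => ?_
  rw [π.law_eq_setLIntegral ν ν' k (hSk k)]
  refine setLIntegral_congr_fun (hSm k) fun ω hω => ?_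
  have hkn : k ≤ n := Nat.lt_succ_iff.1 (Finset.mem_range.1 hk)
  have hmin : min (π.stopTime ω) (n : WithTop ℕ) = k := hω.2
  -- on `min τ n = k` the stopped sum consists of its first `k` terms
  have : π.stoppedLLR ν ν' n ω = ∑ r ∈ Finset.range k, ν.stepLLR ν' (ω r) := by
    rw [stoppedLLR, ← Finset.sum_filter]
    congr 1
    ext s
    have h1 : (s : WithTop ℕ) < min (π.stopTime ω) n ↔ s < k := by
      rw [hmin]; exact WithTop.coe_lt_coe
    rw [lt_min_iff] at h1
    simp only [Finset.mem_filter, Finset.mem_range]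
    rw [← h1, and_comm]
    exact and_congr_right fun _ => WithTop.coe_lt_coe.symm
  simp only [this]

/-- The data-processing inequality in variational form: the relative entropy collected up to
`min τ n` dominates the Donsker–Varadhan functional of `c` times the indicator of `E`. It is
Jensen's inequality for the stopped likelihood ratio. -/
theorem mul_measure_sub_log_le (π : Algorithm K) (ν ν' : BanditInstance F K) (n : ℕ)
    {E : Set (Run K)}
    (hE : MeasurableSet[(π.isStoppingTime.min_const n).measurableSpace] E) (c : ℝ) :
    c * (π.law ν).real E - Real.log (1 + (Real.exp c - 1) * (π.law ν').real E) ≤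
      ∑ s ∈ Finset.range n, ∑ j, (π.pullProb ν s j).toReal * F.kl (ν.param j) (ν'.param j) := by
  have hEm : MeasurableSet E := (π.isStoppingTime.min_const n).measurableSpace_le E hE
  set Z := π.stoppedLLR ν ν' n with hZ
  have hZi : Integrable Z (π.law ν) := π.integrable_stoppedLLR ν ν' n
  -- real-valued form of the change of measure, for `E` and for its complement
  have hexp : ∀ {A : Set (Run K)},
      MeasurableSet[(π.isStoppingTime.min_const n).measurableSpace] A →
      IntegrableOn (fun ω => Real.exp (-Z ω)) A (π.law ν) ∧
        ∫ ω in A, Real.exp (-Z ω) ∂(π.law ν) = (π.law ν').real A := by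
    intro A hA
    have h := π.law_eq_setLIntegral_stoppedLLR ν ν' n hA
    have hm : AEStronglyMeasurable (fun ω => Real.exp (-Z ω)) ((π.law ν).restrict A) :=
      (Real.continuous_exp.comp_aestronglyMeasurable hZi.1.neg).restrict
    constructor
    · refine ⟨hm, ?_⟩
      rw [hasFiniteIntegral_iff_ofReal (ae_of_all _ fun _ => (Real.exp_pos _).le), ← h]
      exact measure_lt_top _ _
    · rw [integral_eq_lintegral_of_nonneg_ae (ae_of_all _ fun _ => (Real.exp_pos _).le) hm, ← h]
      rfl
  obtain ⟨hi1, he1⟩ := hexp hE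
  obtain ⟨hi2, he2⟩ := hexp hE.compl
  set Y : Run K → ℝ := fun ω => E.indicator (fun _ => c) ω - Z ω with hY
  have hindi : Integrable (E.indicator fun _ => c) (π.law ν) :=
    (integrable_const c).indicator hEm
  have hYi : Integrable Y (π.law ν) := hindi.sub hZi
  have hexpY : (fun ω => Real.exp (Y ω)) = fun ω =>
      E.indicator (fun ω => Real.exp c * Real.exp (-Z ω)) ω +
        Eᶜ.indicator (fun ω => Real.exp (-Z ω)) ω := by
    funext ω
    by_cases hω : ω ∈ E
    · simp [hY, hω, sub_eq_add_neg, Real.exp_add]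
    · simp [hY, hω]
  have hj1 : Integrable (E.indicator fun ω => Real.exp c * Real.exp (-Z ω)) (π.law ν) :=
    (integrable_indicator_iff hEm).2 (hi1.const_mul _)
  have hj2 : Integrable (Eᶜ.indicator fun ω => Real.exp (-Z ω)) (π.law ν) :=
    (integrable_indicator_iff hEm.compl).2 hi2
  have hYe : Integrable (fun ω => Real.exp (Y ω)) (π.law ν) := hexpY ▸ hj1.add hj2
  set M : ℝ := 1 + (Real.exp c - 1) * (π.law ν').real E with hM
  have hYM : ∫ ω, Real.exp (Y ω) ∂(π.law ν) = M := by
    rw [hexpY, integral_add hj1 hj2, integral_indicator hEm, integral_indicator hEm.compl,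
      integral_const_mul, he1, he2, probReal_compl_eq_one_sub hEm, hM]
    ring
  have hMpos : 0 < M := by
    rw [← hYM]
    exact integral_exp_pos hYe
  -- Jensen's inequality in tangent-line form: `y - log M ≤ exp (y - log M) - 1`
  have hle : ∫ ω, (Y ω - Real.log M) ∂(π.law ν) ≤
      ∫ ω, (Real.exp (Y ω) * M⁻¹ - 1) ∂(π.law ν) := by
    refine integral_mono (hYi.sub (integrable_const _))
      ((hYe.mul_const _).sub (integrable_const _)) fun ω => ?_
    have := Real.add_one_le_exp (Y ω - Real.log M)
    rw [Real.exp_sub, Real.exp_log hMpos, div_eq_mul_inv] at this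
    simp only
    linarith
  rw [integral_sub hYi (integrable_const _),
    integral_sub (hYe.mul_const _) (integrable_const _), integral_mul_const, hYM,
    mul_inv_cancel₀ hMpos.ne'] at hle
  have hYint : ∫ ω, Y ω ∂(π.law ν) = c * (π.law ν).real E - ∫ ω, Z ω ∂(π.law ν) := by
    rw [hY, integral_sub hindi hZi, integral_indicator_const _ hEm, smul_eq_mul, mul_comm]
  rw [hYint, π.integral_stoppedLLR] at hle
  simp at hle
  linarith

end Algorithm

/-! ### The lower bound at a fixed confidence level -/

theorem bernoulliKL_one_sub {δ : ℝ} (h0 : 0 < δ) (h1 : δ < 1) :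
    bernoulliKL δ (1 - δ) = (1 - 2 * δ) * (Real.log (1 - δ) - Real.log δ) := by
  have : 1 - δ ≠ 0 := by linarith
  rw [bernoulliKL, sub_sub_cancel, Real.log_div h0.ne' this, Real.log_div this h0.ne']
  ring

theorem bernoulliKL_one_sub_nonneg {δ : ℝ} (h0 : 0 < δ) (h1 : δ ≤ 1 / 2) :
    0 ≤ bernoulliKL δ (1 - δ) := by
  rw [bernoulliKL_one_sub h0 (by linarith)]
  exact mul_nonneg (by linarith) (sub_nonneg.2 (Real.log_le_log h0 (by linarith)))

/-- The weight for which the variational formula for the relative entropy of Bernoulli laws is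
attained at means `1 - δ` and `δ`. -/
theorem bernoulliKL_eq_variational {δ : ℝ} (h0 : 0 < δ) (h1 : δ < 1) :
    2 * (Real.log (1 - δ) - Real.log δ) * (1 - δ) -
      Real.log (1 + (Real.exp (2 * (Real.log (1 - δ) - Real.log δ)) - 1) * δ) =
    bernoulliKL δ (1 - δ) := by
  have h2 : 0 < 1 - δ := by linarith
  have he : Real.exp (2 * (Real.log (1 - δ) - Real.log δ)) = ((1 - δ) / δ) ^ 2 := by
    rw [← Real.log_div h2.ne' h0.ne', ← Real.exp_log (div_pos h2 h0), ← Real.exp_nat_mul,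
      Real.log_exp]
    norm_num
  have : 1 + (((1 - δ) / δ) ^ 2 - 1) * δ = (1 - δ) / δ := by
    field_simp; ring
  rw [he, this, bernoulliKL_one_sub h0 h1, Real.log_div h2.ne' h0.ne']
  ring

namespace BanditInstance

variable {F : ExpFamily} {K : ℕ}

/-- The alternative instance in which arm `i` gets the parameter of arm `a` and arm `a` the
parameter `t`. -/
def swapUp (ν : BanditInstance F K) (a i : Fin K) {t : ℝ} (ht : t ∈ F.params) :
    BanditInstance F K where
  param := Function.update (Function.update ν.param i (ν.param a)) a t
  mem j := by
    by_cases hj : j = a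
    · subst hj; simpa using ht
    · by_cases hi : j = i
      · subst hi; simpa [hj] using ν.mem a
      · simpa [hj, hi] using ν.mem j

theorem IsBest.param_lt {ν : BanditInstance F K} {a i : Fin K} (ha : ν.IsBest a) (hi : i ≠ a) :
    ν.param i < ν.param a :=
  (F.strictMonoOn_mean.lt_iff_lt (ν.mem i) (ν.mem a)).1 (ha i hi)

theorem IsBest.swapUp {ν : BanditInstance F K} {a i : Fin K} (ha : ν.IsBest a) (hi : i ≠ a)
    {t : ℝ} (ht : t ∈ F.params) (hlt : t < ν.param a) : (ν.swapUp a i ht).IsBest i := by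
  have hmi : (ν.swapUp a i ht).mean i = F.mean (ν.param a) := by
    simp [BanditInstance.mean, BanditInstance.swapUp, hi]
  intro j hj
  rw [hmi]
  by_cases hja : j = a
  · subst hja
    have : (ν.swapUp j i ht).mean j = F.mean t := by
      simp [BanditInstance.mean, BanditInstance.swapUp]
    rw [this]
    exact F.strictMonoOn_mean ht (ν.mem _) hlt
  · have : (ν.swapUp a i ht).mean j = ν.mean j := by
      simp [BanditInstance.mean, BanditInstance.swapUp, hja, hj]
    rw [this]
    exact ha j hja

theorem IsBest.gap_nonneg {ν : BanditInstance F K} {a : Fin K} (ha : ν.IsBest a) (i : Fin K) :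
    0 ≤ ν.gap a i := by
  by_cases hi : i = a
  · simp [gap, hi]
  · exact (sub_pos.2 (ha i hi)).le

end BanditInstance

namespace Algorithm

variable {F : ExpFamily} {K : ℕ}

theorem measurableSet_out_eq_and_le (π : Algorithm K) (a : Fin K) (n : ℕ) :
    MeasurableSet[(π.isStoppingTime.min_const n).measurableSpace]
      ({ω | π.out ω = a} ∩ {ω | π.stopTime ω ≤ (n : WithTop ℕ)}) := by
  have h1 : MeasurableSet[π.isStoppingTime.measurableSpace] {ω | π.out ω = a} :=
    π.measurable_out (measurableSet_singleton a)
  rw [π.isStoppingTime.measurableSpace_min_const]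
  exact ⟨h1.inter (π.isStoppingTime.measurableSet_le' n), h1.2 n⟩

/-- The variational bound for arm `i` against arm `a`, truncated at time `n`. The alternatives
`swapUp` with the parameter `t` of arm `a` below `θ_a` have best arm `i`; in the limit `t → θ_a`
the at most `n` pulls of arm `a` carry no information. -/
theorem variational_le_sum_pullProb {π : Algorithm K} {δ : ℝ} (hδ : 0 < δ) (hδ' : δ ≤ 1 / 2)
    (hπ : π.IsPAC F δ) {ν : BanditInstance F K} {a i : Fin K} (ha : ν.IsBest a) (hi : i ≠ a)
    (n : ℕ) {c : ℝ} (hc : 0 ≤ c) :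
    c * (π.law ν).real ({ω | π.out ω = a} ∩ {ω | π.stopTime ω ≤ (n : WithTop ℕ)}) -
      Real.log (1 + (Real.exp c - 1) * δ) ≤
    F.kl (ν.param i) (ν.param a) * ∑ s ∈ Finset.range n, (π.pullProb ν s i).toReal := by
  set E := {ω | π.out ω = a} ∩ {ω | π.stopTime ω ≤ (n : WithTop ℕ)} with hE
  have hlt := ha.param_lt hi
  have hsub : Set.Ioo (ν.param i) (ν.param a) ⊆ F.params := fun t ht =>
    F.convex_params.ordConnected.out (ν.mem i) (ν.mem a) ⟨ht.1.le, ht.2.le⟩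
  have hexp : 0 ≤ Real.exp c - 1 := sub_nonneg.2 (Real.one_le_exp hc)
  -- the bound against a single alternative instance
  have hstep : ∀ t ∈ Set.Ioo (ν.param i) (ν.param a),
      c * (π.law ν).real E - Real.log (1 + (Real.exp c - 1) * δ) ≤
      F.kl (ν.param i) (ν.param a) * ∑ s ∈ Finset.range n, (π.pullProb ν s i).toReal +
        n * F.kl (ν.param a) t := by
    intro t ht
    set ν' := ν.swapUp a i (hsub ht) with hν'
    have hν'i : ν'.param i = ν.param a := by simp [hν', BanditInstance.swapUp, hi]
    have hν'a : ν'.param a = t := by simp [hν', BanditInstance.swapUp]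
    have hν'j : ∀ j, j ≠ i → j ≠ a → ν'.param j = ν.param j := fun j h1 h2 => by
      simp [hν', BanditInstance.swapUp, h1, h2]
    have hbest : ν'.IsBest i := ha.swapUp hi (hsub ht) ht.2
    have hq : (π.law ν').real E ≤ δ := by
      refine ENNReal.toReal_le_of_le_ofReal hδ.le ((measure_mono ?_).trans (hπ ν' i hbest).2)
      rintro ω ⟨hω, -⟩
      exact fun h => hi (h.symm.trans hω)
    have hmain := π.mul_measure_sub_log_le ν ν' n (π.measurableSet_out_eq_and_le a n) c
    have hlog : Real.log (1 + (Real.exp c - 1) * (π.law ν').real E) ≤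
        Real.log (1 + (Real.exp c - 1) * δ) := by
      refine Real.log_le_log ?_ (by gcongr)
      have := mul_nonneg hexp (measureReal_nonneg (μ := π.law ν') (s := E))
      linarith
    have hsum : ∀ s, ∑ j, (π.pullProb ν s j).toReal * F.kl (ν.param j) (ν'.param j) =
        (π.pullProb ν s i).toReal * F.kl (ν.param i) (ν.param a) +
          (π.pullProb ν s a).toReal * F.kl (ν.param a) t := by
      intro s
      rw [Finset.sum_eq_add_of_mem i a (Finset.mem_univ _) (Finset.mem_univ _) hi, hν'i, hν'a]
      intro j _ hj
      rw [hν'j j hj.1 hj.2, F.kl_self, mul_zero]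
    have hpa : ∑ s ∈ Finset.range n, (π.pullProb ν s a).toReal ≤ n := by
      calc ∑ s ∈ Finset.range n, (π.pullProb ν s a).toReal
          ≤ ∑ s ∈ Finset.range n, (1 : ℝ) :=
            Finset.sum_le_sum fun s _ => measureReal_le_one (μ := π.law ν)
        _ = n := by simp
    simp only [hsum, Finset.sum_add_distrib, ← Finset.sum_mul] at hmain
    have := mul_le_mul_of_nonneg_right hpa (F.kl_nonneg (ν.mem a) (hsub ht))
    linarith
  have hne : (𝓝[Set.Ioo (ν.param i) (ν.param a)] (ν.param a)).NeBot :=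
    right_nhdsWithin_Ioo_neBot hlt
  have hlim : Tendsto (fun t =>
      F.kl (ν.param i) (ν.param a) * ∑ s ∈ Finset.range n, (π.pullProb ν s i).toReal +
        n * F.kl (ν.param a) t) (𝓝[Set.Ioo (ν.param i) (ν.param a)] (ν.param a))
      (𝓝 (F.kl (ν.param i) (ν.param a) * ∑ s ∈ Finset.range n, (π.pullProb ν s i).toReal)) := by
    simpa using (((F.tendsto_kl (ν.mem a)).mono_left (nhdsWithin_mono _ hsub)).const_mul
      (n : ℝ)).const_add
        (F.kl (ν.param i) (ν.param a) * ∑ s ∈ Finset.range n, (π.pullProb ν s i).toReal)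
  exact ge_of_tendsto hlim (eventually_nhdsWithin_of_forall hstep)

/-- The expected number of pulls of arm `j`. -/
def expectedPulls (π : Algorithm K) (ν : BanditInstance F K) (j : Fin K) : ℝ≥0∞ :=
  ∑' s, π.pullProb ν s j

/-- A correct algorithm collects at least `kl_B(δ, 1 - δ)` of information from every suboptimal
arm about the possibility that this arm ties with the best one. -/
theorem bernoulliKL_le_mul_expectedPulls {π : Algorithm K} {δ : ℝ} (hδ : 0 < δ)
    (hδ' : δ ≤ 1 / 2) (hπ : π.IsPAC F δ) {ν : BanditInstance F K} {a i : Fin K}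
    (ha : ν.IsBest a) (hi : i ≠ a) :
    ENNReal.ofReal (bernoulliKL δ (1 - δ)) ≤
      ENNReal.ofReal (F.kl (ν.param i) (ν.param a)) * π.expectedPulls ν i := by
  set c := 2 * (Real.log (1 - δ) - Real.log δ) with hc
  have hc0 : 0 ≤ c :=
    mul_nonneg zero_le_two (sub_nonneg.2 (Real.log_le_log hδ (by linarith)))
  have hkl := F.kl_nonneg (ν.mem i) (ν.mem a)
  set E : ℕ → Set (Run K) :=
    fun n => {ω | π.out ω = a} ∩ {ω | π.stopTime ω ≤ (n : WithTop ℕ)} with hE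
  have hmono : Monotone E := fun m n hmn ω hω =>
    ⟨hω.1, le_trans hω.2 (WithTop.coe_le_coe.2 hmn : (m : WithTop ℕ) ≤ (n : WithTop ℕ))⟩
  have hEm : ∀ n, MeasurableSet (E n) := fun n =>
    (π.isStoppingTime.min_const n).measurableSpace_le _ (π.measurableSet_out_eq_and_le a n)
  have hlim : Tendsto (fun n => (π.law ν).real (E n)) atTop
      (𝓝 ((π.law ν).real (⋃ n, E n))) :=
    (ENNReal.tendsto_toReal (measure_ne_top _ _)).comp (tendsto_measure_iUnion_atTop hmono)
  have hunion : 1 - δ ≤ (π.law ν).real (⋃ n, E n) := by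
    have hm : MeasurableSet (⋃ n, E n) := MeasurableSet.iUnion hEm
    have hcompl : (π.law ν).real (⋃ n, E n)ᶜ ≤ δ := by
      refine ENNReal.toReal_le_of_le_ofReal hδ.le (le_trans (measure_mono_ae ?_) (hπ ν a ha).2)
      filter_upwards [(hπ ν a ha).1] with ω hω hω2
      obtain ⟨n, hn⟩ := WithTop.ne_top_iff_exists.1 hω
      exact fun h => hω2 (Set.mem_iUnion.2 ⟨n, h, hn.ge⟩)
    rw [probReal_compl_eq_one_sub hm] at hcompl
    linarith
  set C := Real.log (1 + (Real.exp c - 1) * δ) with hC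
  have hn : ∀ n, ENNReal.ofReal (c * (π.law ν).real (E n) - C) ≤
      ENNReal.ofReal (F.kl (ν.param i) (ν.param a)) * π.expectedPulls ν i := by
    intro n
    refine (ENNReal.ofReal_le_ofReal
      (variational_le_sum_pullProb hδ hδ' hπ ha hi n hc0)).trans ?_
    rw [ENNReal.ofReal_mul hkl]
    gcongr
    rw [ENNReal.ofReal_sum_of_nonneg fun _ _ => ENNReal.toReal_nonneg]
    simp only [ENNReal.ofReal_toReal (π.pullProb_ne_top ν _ i)]
    exact ENNReal.sum_le_tsum _
  have hlim2 : Tendsto (fun n => ENNReal.ofReal (c * (π.law ν).real (E n) - C)) atTop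
      (𝓝 (ENNReal.ofReal (c * (π.law ν).real (⋃ n, E n) - C))) :=
    (ENNReal.continuous_ofReal.tendsto _).comp ((hlim.const_mul c).sub_const C)
  refine le_trans (ENNReal.ofReal_le_ofReal ?_) (le_of_tendsto' hlim2 hn)
  rw [← bernoulliKL_eq_variational hδ (by linarith)]
  gcongr

theorem expectedRegret_eq_sum (π : Algorithm K) (ν : BanditInstance F K) (a : Fin K) :
    π.expectedRegret ν a = ∑ j, ENNReal.ofReal (ν.gap a j) * π.expectedPulls ν j := by
  have h1 : ∀ (s : ℕ) (ω : Run K), (if (s : WithTop ℕ) < π.stopTime ω then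
      ENNReal.ofReal (ν.gap a (ω s).1) else 0) =
      ∑ j, {ω : Run K | (s : WithTop ℕ) < π.stopTime ω ∧ (ω s).1 = j}.indicator
        (fun _ => ENNReal.ofReal (ν.gap a j)) ω := fun s ω =>
    π.ite_stopTime_eq_sum s (fun j _ => ENNReal.ofReal (ν.gap a j)) ω
  have hm : ∀ (s : ℕ) (j : Fin K), Measurable ({ω : Run K | (s : WithTop ℕ) < π.stopTime ω ∧
      (ω s).1 = j}.indicator fun _ => ENNReal.ofReal (ν.gap a j)) := fun s j =>
    measurable_const.indicator (π.measurableSet_pull s j)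
  simp only [expectedRegret, h1]
  rw [lintegral_tsum fun s => (Finset.measurable_sum _ fun j _ => hm s j).aemeasurable]
  have h2 : ∀ s : ℕ, ∫⁻ ω, ∑ j, {ω : Run K | (s : WithTop ℕ) < π.stopTime ω ∧
      (ω s).1 = j}.indicator (fun _ => ENNReal.ofReal (ν.gap a j)) ω ∂(π.law ν) =
      ∑ j, ENNReal.ofReal (ν.gap a j) * π.pullProb ν s j := by
    intro s
    rw [lintegral_finsetSum _ fun j _ => hm s j]
    refine Finset.sum_congr rfl fun j _ => ?_
    rw [lintegral_indicator_const (π.measurableSet_pull s j)]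
    rfl
  simp only [h2, expectedPulls]
  rw [Summable.tsum_finsetSum fun _ _ => ENNReal.summable]
  simp only [ENNReal.tsum_mul_left]

theorem ofReal_hardness_mul_le_expectedRegret {π : Algorithm K} {δ : ℝ} (hδ : 0 < δ)
    (hδ' : δ ≤ 1 / 2) (hπ : π.IsPAC F δ) {ν : BanditInstance F K} {a : Fin K}
    (ha : ν.IsBest a) :
    ENNReal.ofReal (ν.hardness a * bernoulliKL δ (1 - δ)) ≤ π.expectedRegret ν a := by
  have hB := bernoulliKL_one_sub_nonneg hδ hδ'
  rw [π.expectedRegret_eq_sum, BanditInstance.hardness, Finset.sum_mul]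
  have hkl : ∀ i, 0 ≤ F.kl (ν.param i) (ν.param a) := fun i => F.kl_nonneg (ν.mem i) (ν.mem a)
  rw [ENNReal.ofReal_sum_of_nonneg fun i _ =>
    mul_nonneg (div_nonneg (ha.gap_nonneg i) (hkl i)) hB]
  refine (Finset.sum_le_sum fun i hi => ?_).trans
    (Finset.sum_le_sum_of_subset (Finset.erase_subset a Finset.univ))
  have hia : i ≠ a := Finset.ne_of_mem_erase hi
  rcases (hkl i).eq_or_lt with h0 | hpos
  · -- an arm with zero divergence would contribute `Δ / 0 = 0`
    simp [← h0]
  · have h := bernoulliKL_le_mul_expectedPulls hδ hδ' hπ ha hia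
    calc ENNReal.ofReal (ν.gap a i / F.kl (ν.param i) (ν.param a) * bernoulliKL δ (1 - δ))
        = ENNReal.ofReal (ν.gap a i / F.kl (ν.param i) (ν.param a)) *
            ENNReal.ofReal (bernoulliKL δ (1 - δ)) :=
          ENNReal.ofReal_mul (div_nonneg (ha.gap_nonneg i) (hkl i))
      _ ≤ ENNReal.ofReal (ν.gap a i / F.kl (ν.param i) (ν.param a)) *
            (ENNReal.ofReal (F.kl (ν.param i) (ν.param a)) * π.expectedPulls ν i) := by gcongr
      _ = ENNReal.ofReal (ν.gap a i) * π.expectedPulls ν i := by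
          rw [← mul_assoc, ← ENNReal.ofReal_mul (div_nonneg (ha.gap_nonneg i) (hkl i)),
            div_mul_cancel₀ _ hpos.ne']

end Algorithm

/-! ### Realized regret and small confidence levels -/

namespace Algorithm

variable {F : ExpFamily} {K : ℕ}

theorem toENNReal_eq_tsum (t : ℕ∞) :
    ENat.toENNReal t = ∑' s : ℕ, if (s : ℕ∞) < t then (1 : ℝ≥0∞) else 0 := by
  induction t using ENat.recTopCoe with
  | top => simp
  | coe n =>
    rw [tsum_eq_sum (s := Finset.range n) fun s hs => by
      rw [if_neg]; simpa using hs]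
    rw [Finset.sum_congr rfl fun s hs => if_pos (by simpa using hs)]
    simp

theorem expectedPulls_le_expectedStop (π : Algorithm K) (ν : BanditInstance F K) (j : Fin K) :
    π.expectedPulls ν j ≤ π.expectedStop ν := by
  have hm : ∀ s : ℕ, MeasurableSet {ω : Run K | (s : WithTop ℕ) < π.stopTime ω ∧ (ω s).1 = j} :=
    fun s => π.measurableSet_pull s j
  have h1 : π.expectedPulls ν j = ∫⁻ ω, ∑' s : ℕ,
      {ω : Run K | (s : WithTop ℕ) < π.stopTime ω ∧ (ω s).1 = j}.indicator 1 ω ∂(π.law ν) := by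
    rw [lintegral_tsum fun s => (measurable_one.indicator (hm s)).aemeasurable]
    simp only [lintegral_indicator_one (hm _)]
    rfl
  rw [h1]
  refine lintegral_mono fun ω => ?_
  refine le_trans ?_ (toENNReal_eq_tsum (π.stopTime ω)).ge
  refine ENNReal.tsum_le_tsum fun s => ?_
  by_cases h : (s : WithTop ℕ) < π.stopTime ω
  · have h' : (s : ℕ∞) < π.stopTime ω := h
    rw [if_pos h']
    exact Set.indicator_le_self' (by simp) ω
  · rw [Set.indicator_of_notMem fun hω => h hω.1]
    exact bot_le

theorem hasSum_realizedRegret (π : Algorithm K) (ν : BanditInstance F K) (a : Fin K) {ω : Run K}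
    (hω : π.stopTime ω ≠ ⊤) :
    HasSum (fun s : ℕ => if (s : WithTop ℕ) < π.stopTime ω then ν.mean a - (ω s).2 else 0)
      (π.realizedRegret ν a ω) := by
  obtain ⟨n, hn⟩ := WithTop.ne_top_iff_exists.1 hω
  have hlt : ∀ s : ℕ, (s : WithTop ℕ) < π.stopTime ω ↔ s < n := fun s => by
    rw [← hn]; exact WithTop.coe_lt_coe
  simp only [realizedRegret, hlt]
  rw [← hn, WithTop.untopD_coe]
  rw [Finset.sum_congr rfl fun s hs => (if_pos (by simpa using hs :
    s < n) : (if s < n then ν.mean a - (ω s).2 else 0) = _).symm]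
  exact hasSum_sum_of_ne_finset_zero fun s hs => if_neg (by simpa using hs)

/-- Wald's identity: the conditional mean of `μ_a - X_t` given the past and `A_t` is the gap of
`A_t`, and `E[τ] < ∞` makes the sum over the rounds absolutely convergent. -/
theorem realizedRegret_spec (π : Algorithm K) {ν : BanditInstance F K} {a : Fin K}
    (ha : ν.IsBest a) (hfin : ∀ᵐ ω ∂(π.law ν), π.stopTime ω ≠ ⊤)
    (hτ : π.expectedStop ν ≠ ⊤) :
    Integrable (π.realizedRegret ν a) (π.law ν) ∧
      0 ≤ ∫ ω, π.realizedRegret ν a ω ∂(π.law ν) ∧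
      ENNReal.ofReal (∫ ω, π.realizedRegret ν a ω ∂(π.law ν)) = π.expectedRegret ν a := by
  have hpulls : ∀ j, π.expectedPulls ν j ≠ ⊤ := fun j =>
    ne_top_of_le_ne_top hτ (π.expectedPulls_le_expectedStop ν j)
  have hsum : ∀ j, HasSum (fun s => (π.pullProb ν s j).toReal) (π.expectedPulls ν j).toReal :=
    fun j => by
      rw [expectedPulls, ENNReal.tsum_toReal_eq fun s => π.pullProb_ne_top ν s j]
      exact ENNReal.hasSum_toReal (hpulls j)
  have hφ : ∀ j, Integrable (fun x => ν.mean a - x) (F.dist (ν.param j)) := fun j => by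
    have := F.isProbabilityMeasure_dist (ν.mem j)
    exact (integrable_const _).sub (F.integrable_id_dist (ν.mem j))
  have hφint : ∀ j, ∫ x, (ν.mean a - x) ∂(F.dist (ν.param j)) = ν.gap a j := fun j => by
    have := F.isProbabilityMeasure_dist (ν.mem j)
    rw [integral_sub (integrable_const _) (F.integrable_id_dist (ν.mem j))]
    simp [BanditInstance.gap, BanditInstance.mean, ExpFamily.mean]
  set f : ℕ → Run K → ℝ := fun s ω =>
    if (s : WithTop ℕ) < π.stopTime ω then ν.mean a - (ω s).2 else 0 with hf
  have hfi : ∀ s, Integrable (f s) (π.law ν) := fun s =>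
    π.integrable_ite_stopTime ν s (φ := fun _ x => ν.mean a - x) hφ
  have hfv : ∀ s, ∫ ω, f s ω ∂(π.law ν) = ∑ j, (π.pullProb ν s j).toReal * ν.gap a j := by
    intro s
    simp only [← hφint]
    exact π.integral_ite_stopTime ν s (φ := fun _ x => ν.mean a - x) hφ
  have hfn : ∀ s, ∫ ω, ‖f s ω‖ ∂(π.law ν) =
      ∑ j, (π.pullProb ν s j).toReal * ∫ x, |ν.mean a - x| ∂(F.dist (ν.param j)) := by
    intro s
    rw [← π.integral_ite_stopTime ν s (φ := fun _ x => |ν.mean a - x|) fun j => (hφ j).abs]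
    refine integral_congr_ae (ae_of_all _ fun ω => ?_)
    simp only [hf]
    split_ifs <;> simp
  have hnorm : Summable fun s => ∫ ω, ‖f s ω‖ ∂(π.law ν) := by
    simp only [hfn]
    exact summable_sum fun j _ => (hsum j).summable.mul_right _
  have hae : π.realizedRegret ν a =ᵐ[π.law ν] fun ω => ∑' s, f s ω := by
    filter_upwards [hfin] with ω hω
    exact (π.hasSum_realizedRegret ν a hω).tsum_eq.symm
  have hval : ∫ ω, π.realizedRegret ν a ω ∂(π.law ν) =
      ∑ j, (π.expectedPulls ν j).toReal * ν.gap a j := by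
    rw [integral_congr_ae hae]
    refine (hasSum_integral_of_summable_integral_norm hfi hnorm).unique ?_
    simp only [hfv]
    exact hasSum_sum fun j _ => (hsum j).mul_right _
  refine ⟨?_, ?_, ?_⟩
  · constructor
    · refine aestronglyMeasurable_of_tendsto_ae atTop
        (f := fun m ω => ∑ s ∈ Finset.range m, f s ω)
        (fun m => (integrable_finsetSum _ fun s _ => hfi s).1) ?_
      filter_upwards [hfin] with ω hω
      exact (π.hasSum_realizedRegret ν a hω).tendsto_sum_nat
    · calc ∫⁻ ω, ‖π.realizedRegret ν a ω‖ₑ ∂(π.law ν)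
          ≤ ∫⁻ ω, ∑' s, ‖f s ω‖ₑ ∂(π.law ν) := by
            refine lintegral_mono_ae ?_
            filter_upwards [hae] with ω hω
            rw [hω]
            exact enorm_tsum_le_tsum_enorm
        _ = ∑' s, ENNReal.ofReal (∫ ω, ‖f s ω‖ ∂(π.law ν)) := by
            rw [lintegral_tsum fun s => (hfi s).1.enorm]
            simp only [ofReal_integral_norm_eq_lintegral_enorm (hfi _)]
        _ < ⊤ := hnorm.tsum_ofReal_lt_top
  · rw [hval]
    exact Finset.sum_nonneg fun j _ => mul_nonneg ENNReal.toReal_nonneg (ha.gap_nonneg j)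
  · rw [hval, π.expectedRegret_eq_sum, ENNReal.ofReal_sum_of_nonneg fun j _ =>
      mul_nonneg ENNReal.toReal_nonneg (ha.gap_nonneg j)]
    refine Finset.sum_congr rfl fun j _ => ?_
    rw [ENNReal.ofReal_mul ENNReal.toReal_nonneg, ENNReal.ofReal_toReal (hpulls j), mul_comm]

end Algorithm

theorem tendsto_bernoulliKL_div_log :
    Tendsto (fun δ : ℝ => bernoulliKL δ (1 - δ) / Real.log (1 / δ)) (𝓝[>] 0) (𝓝 1) := by
  have hid : Tendsto (fun δ : ℝ => δ) (𝓝[>] 0) (𝓝 0) := tendsto_id.mono_left inf_le_left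
  have hL : Tendsto (fun δ : ℝ => Real.log (1 / δ)) (𝓝[>] 0) atTop := by
    simp only [one_div]
    exact Real.tendsto_log_atTop.comp tendsto_inv_nhdsGT_zero
  have h1 : Tendsto (fun δ : ℝ => Real.log (1 - δ)) (𝓝[>] 0) (𝓝 0) := by
    have := (Real.continuousAt_log (x := 1 - 0) (by norm_num)).tendsto.comp (hid.const_sub 1)
    simpa [Function.comp_def] using this
  have h2 := ((hid.const_mul 2).const_sub 1).mul ((h1.div_atTop hL).add_const 1)
  simp only [mul_zero, sub_zero, zero_add, mul_one] at h2
  refine h2.congr' ?_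
  filter_upwards [Ioo_mem_nhdsGT (zero_lt_one (α := ℝ))] with δ hδ
  have hpos : 0 < Real.log (1 / δ) := Real.log_pos (by rw [lt_div_iff₀ hδ.1]; linarith [hδ.2])
  rw [bernoulliKL_one_sub hδ.1 hδ.2, mul_div_assoc]
  congr 1
  rw [div_add_one hpos.ne']
  congr 1
  rw [one_div, Real.log_inv]; ring

end BanditBAI

end

theorem theorem1 (F : BanditBAI.ExpFamily) (K : ℕ) (ν : BanditBAI.BanditInstance F K)
    (a : Fin K) (ha : ν.IsBest a) :
    -- the lower bound at a fixed confidence level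
    (∀ δ : ℝ, 0 < δ → δ ≤ 1 / 2 → ∀ π : BanditBAI.Algorithm K, π.IsPAC F δ →
      ENNReal.ofReal (ν.hardness a * BanditBAI.bernoulliKL δ (1 - δ)) ≤ π.expectedRegret ν a ∧
      -- the realized regret, when the expected sample complexity is finite
      (π.expectedStop ν ≠ ⊤ →
        Integrable (π.realizedRegret ν a) (π.law ν) ∧
        ENNReal.ofReal (∫ ω, π.realizedRegret ν a ω ∂(π.law ν)) = π.expectedRegret ν a ∧
        ν.hardness a * BanditBAI.bernoulliKL δ (1 - δ)
          ≤ ∫ ω, π.realizedRegret ν a ω ∂(π.law ν))) ∧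
    -- the asymptotic lower bound, for algorithms indexed by the confidence level
    (∀ π : ℝ → BanditBAI.Algorithm K, (∀ᶠ δ in 𝓝[>] (0 : ℝ), (π δ).IsPAC F δ) →
      ENNReal.ofReal (ν.hardness a) ≤
        liminf (fun δ : ℝ => (π δ).expectedRegret ν a / ENNReal.ofReal (Real.log (1 / δ)))
          (𝓝[>] (0 : ℝ)) ∧
      ((∀ᶠ δ in 𝓝[>] (0 : ℝ), (π δ).expectedStop ν ≠ ⊤) →
        ((ν.hardness a : ℝ) : EReal) ≤
          liminf (fun δ : ℝ =>
            (((∫ ω, (π δ).realizedRegret ν a ω ∂((π δ).law ν)) / Real.log (1 / δ) : ℝ) : EReal))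
            (𝓝[>] (0 : ℝ)))) := by
  have hfixed : ∀ δ : ℝ, 0 < δ → δ ≤ 1 / 2 → ∀ π : BanditBAI.Algorithm K, π.IsPAC F δ →
      π.expectedStop ν ≠ ⊤ →
      Integrable (π.realizedRegret ν a) (π.law ν) ∧
        ENNReal.ofReal (∫ ω, π.realizedRegret ν a ω ∂(π.law ν)) = π.expectedRegret ν a ∧
        ν.hardness a * BanditBAI.bernoulliKL δ (1 - δ)
          ≤ ∫ ω, π.realizedRegret ν a ω ∂(π.law ν) := by
    intro δ hδ hδ' π hπ hτ
    obtain ⟨h1, h2, h3⟩ := π.realizedRegret_spec ha (hπ ν a ha).1 hτ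
    refine ⟨h1, h3, ?_⟩
    rw [← ENNReal.ofReal_le_ofReal_iff h2, h3]
    exact BanditBAI.Algorithm.ofReal_hardness_mul_le_expectedRegret hδ hδ' hπ ha
  refine ⟨fun δ hδ hδ' π hπ =>
    ⟨BanditBAI.Algorithm.ofReal_hardness_mul_le_expectedRegret hδ hδ' hπ ha,
      hfixed δ hδ hδ' π hπ⟩, fun π hπ => ?_⟩
  have hlim : Tendsto (fun δ : ℝ => ν.hardness a *
      (BanditBAI.bernoulliKL δ (1 - δ) / Real.log (1 / δ))) (𝓝[>] 0) (𝓝 (ν.hardness a)) := by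
    simpa using BanditBAI.tendsto_bernoulliKL_div_log.const_mul (ν.hardness a)
  have hsmall : ∀ᶠ δ : ℝ in 𝓝[>] 0, 0 < δ ∧ δ ≤ 1 / 2 ∧ 0 < Real.log (1 / δ) := by
    filter_upwards [Ioo_mem_nhdsGT (one_half_pos (α := ℝ))] with δ hδ
    exact ⟨hδ.1, hδ.2.le, Real.log_pos (by rw [lt_div_iff₀ hδ.1]; linarith [hδ.2])⟩
  constructor
  · rw [← ((ENNReal.continuous_ofReal.tendsto _).comp hlim).liminf_eq]
    refine liminf_le_liminf ?_
    filter_upwards [hsmall, hπ] with δ hδ hπδ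
    rw [Function.comp, ← mul_div_assoc, ENNReal.ofReal_div_of_pos hδ.2.2]
    exact ENNReal.div_le_div_right
      (BanditBAI.Algorithm.ofReal_hardness_mul_le_expectedRegret hδ.1 hδ.2.1 hπδ ha) _
  · intro hτ
    rw [← ((continuous_coe_real_ereal.tendsto _).comp hlim).liminf_eq]
    refine liminf_le_liminf ?_
    filter_upwards [hsmall, hπ, hτ] with δ hδ hπδ hs
    rw [Function.comp, ← mul_div_assoc, EReal.coe_le_coe_iff]
    have := (hfixed δ hδ.1 hδ.2.1 (π δ) hπδ hs).2.2
    have := hδ.2.2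
    gcongr
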